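/- Let $\Sigma\subset\mathbb R^{d+1}$ be a smooth ($C^\infty$), compact, connected, embedded hypersurface without boundary, with the metric induced by the Euclidean inner product $(\cdot\,|\,\cdot)$, and let $\mathcal P_\Sigma$ denote the orthogonal projection of $\mathbb R^{d+1}$ onto the tangent spaces of $\Sigma$. For a $C^1$ vector field $u$ on $\Sigma$ put, with a local tangent basis $\tau_i$ and its dual basis $\tau^i$, $\nabla_\Sigma u=\tau^i\otimes\partial_i u$, $\operatorname{div}_\Sigma u=(\tau^i|\partial_i u)$ and $\mathcal D_\Sigma(u)=\tfrac12\mathcal P_\Sigma(\nabla_\Sigma u+[\nabla_\Sigma u]^{\sf T})\mathcal P_\Sigma$; for a $C^1$ tensor field $K$ put $\operatorname{div}_\Sigma K=(\partial_iK)^{\sf T}\tau^i$. Let $\mu_s>0$ and consider the surface Navier–Stokes equations (with density one) $$\partial_t u+\mathcal P_\Sigma(u\cdot\nabla_\Sigma u)-\mathcal P_\Sigma\operatorname{div}_\Sigma\mathcal T_\Sigma(u,\pi)=0,\qquad \operatorname{div}_\Sigma u=0\quad\text{on }\Sigma,$$ where $\mathcal T_\Sigma(u,\pi)=2\mu_s\mathcal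 D_\Sigma(u)-\pi\mathcal P_\Sigma$ and $u\cdot\nabla_\Sigma v=u^i\partial_i v$. An equilibrium is a time-independent solution $(u,\pi)$. (a) The set of equilibria $(u,\pi)$ with $u\in C^2(\Sigma,{\sf T}\Sigma)$ (a tangential $C^2$ field) and $\pi\in C^1(\Sigma)$ is exactly the set of all pairs $(u,\pi)$ with $u\in C^2(\Sigma,{\sf T}\Sigma)$, $\operatorname{div}_\Sigma u=0$ and $\mathcal D_\Sigma(u)=0$ on $\Sigma$, and $\pi=\tfrac12|u|^2+c$ on $\Sigma$ for some constant $c\in\mathbb R$. (b) If $u\in C^1(\Sigma,{\sf T}\Sigma)$ and $\mathcal D_\Sigma(u)=0$ on $\Sigma$, then $\operatorname{div}_\Sigma u=0$ on $\Sigma$. (c) A tangential $C^1$ field $u$ on $\Sigma$ satisfies $\mathcal D_\Sigma(u)=0$ on $\Sigma$ if and only if it is a Killing field of $\Sigma$, i.e. $(\nabla_v u|w)+(\nabla_w u|v)=0$ on $\Sigma$ for all tangential $C^1$ fields $v,w$ on $\Sigma$, where $\nabla_v u=\mathcal P_\Sigma(v^i\partial_i u)$ is the Levi-Civita connection of $\Sigma$.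 -/

import Mathlib

open scoped ContDiff Topology

noncomputable section

namespace SurfaceNS

/-- The ambient Euclidean space `ℝ^(d+1)`. -/
abbrev Ambient (d : ℕ) : Type := EuclideanSpace ℝ (Fin (d + 1))

variable {d : ℕ}

/-- `S` is a smooth embedded hypersurface without boundary in `ℝ^(d+1)`: near each of its points
it is the zero set of a smooth function whose differential does not vanish. -/
def IsSmoothHypersurface (S : Set (Ambient d)) : Prop :=
  ∀ p ∈ S, ∃ U : Set (Ambient d), IsOpen U ∧ p ∈ U ∧ ∃ ρ : Ambient d → ℝ,
    ContDiffOn ℝ ∞ ρ U ∧ (∀ x ∈ U, fderiv ℝ ρ x ≠ 0) ∧ S ∩ U = {x ∈ U | ρ x = 0}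

/-- The tangent space of `S` at `p`, as a linear subspace of `ℝ^(d+1)`: the span of the limits of
rescaled secants of `S` at `p`. -/
def tangentSpace (S : Set (Ambient d)) (p : Ambient d) : Submodule ℝ (Ambient d) :=
  Submodule.span ℝ (tangentConeAt ℝ S p)

/-- The orthogonal projection `P_Σ(p)` of `ℝ^(d+1)` onto the tangent space of `S` at `p`. -/
def tangentProj (S : Set (Ambient d)) (p : Ambient d) : Ambient d →L[ℝ] Ambient d :=
  (tangentSpace S p).starProjection

/-- `f` is of class `C^k` on `S`: near each point of `S` it is the restriction to `S` of a map of
class `C^k`. Functions on `S` are represented by functions on the ambient space; here and in all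
the definitions below only their values on `S` matter. -/
def IsContDiffOnSurface {F : Type*} [NormedAddCommGroup F] [NormedSpace ℝ F] (k : ℕ)
    (S : Set (Ambient d)) (f : Ambient d → F) : Prop :=
  ∀ p ∈ S, ∃ g : Ambient d → F, ContDiffAt ℝ k g p ∧ ∀ᶠ x in 𝓝[S] p, g x = f x

/-- `u` is a tangential vector field on `S` of class `C^k`, i.e. `u ∈ C^k(Σ, TΣ)`. -/
def IsTangentialField (k : ℕ) (S : Set (Ambient d)) (u : Ambient d → Ambient d) : Prop :=
  IsContDiffOnSurface k S u ∧ ∀ p ∈ S, u p ∈ tangentSpace S p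

/-- The differential of a function `f` on `S` at `p`, precomposed with the projection onto the
tangent space, `v ↦ (τ^i | v) ∂_i f`. (A derivative within `S` is determined on the tangent
space only, which is why it is composed with the projection.) -/
def surfaceDeriv {F : Type*} [NormedAddCommGroup F] [NormedSpace ℝ F] (S : Set (Ambient d))
    (f : Ambient d → F) (p : Ambient d) : Ambient d →L[ℝ] F :=
  (fderivWithin ℝ f S p) ∘L (tangentProj S p)

/-- The surface gradient `∇_Σ u = τ^i ⊗ ∂_i u` of a vector field, where `(a ⊗ b) v = (b | v) a`.
It is the transpose of the surface differential `∂_i u ⊗ τ^i`. -/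
def surfaceGrad (S : Set (Ambient d)) (u : Ambient d → Ambient d) (p : Ambient d) :
    Ambient d →L[ℝ] Ambient d :=
  ContinuousLinearMap.adjoint (surfaceDeriv S u p)

/-- The surface divergence `div_Σ u = (τ^i | ∂_i u)` of a vector field: the trace of the surface
differential `∂_i u ⊗ τ^i`. -/
def surfaceDiv (S : Set (Ambient d)) (u : Ambient d → Ambient d) (p : Ambient d) : ℝ :=
  LinearMap.trace ℝ (Ambient d) (surfaceDeriv S u p).toLinearMap

/-- The surface divergence `div_Σ K = (∂_i K)ᵀ τ^i` of a tensor field, the contraction over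
`τ_i ⊗ τ^i` being computed in the standard orthonormal basis `e_k` of the ambient space:
`τ_i ⊗ τ^i = P_Σ = ∑ k, (P_Σ e_k) ⊗ e_k`. -/
def surfaceDivTensor (S : Set (Ambient d)) (K : Ambient d → (Ambient d →L[ℝ] Ambient d))
    (p : Ambient d) : Ambient d :=
  ∑ k : Fin (d + 1), ContinuousLinearMap.adjoint
    (surfaceDeriv S K p (EuclideanSpace.single k (1 : ℝ))) (EuclideanSpace.single k (1 : ℝ))

/-- The surface rate-of-strain tensor `D_Σ(u) = (1/2) P_Σ (∇_Σ u + [∇_Σ u]ᵀ) P_Σ`. -/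
def strain (S : Set (Ambient d)) (u : Ambient d → Ambient d) (p : Ambient d) :
    Ambient d →L[ℝ] Ambient d :=
  (1 / 2 : ℝ) • ((tangentProj S p) ∘L
    (surfaceGrad S u p + ContinuousLinearMap.adjoint (surfaceGrad S u p)) ∘L (tangentProj S p))

/-- The Boussinesq-Scriven surface stress tensor `T_Σ(u, π) = 2 μ_s D_Σ(u) - π P_Σ` of an
incompressible fluid. -/
def stress (μ : ℝ) (S : Set (Ambient d)) (u : Ambient d → Ambient d) (π : Ambient d → ℝ)
    (p : Ambient d) : Ambient d →L[ℝ] Ambient d :=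
  (2 * μ) • strain S u p - π p • tangentProj S p

/-- The derivative `v · ∇_Σ u = v^i ∂_i u` of the vector field `u` in the direction of the
tangential field `v`. -/
def convect (S : Set (Ambient d)) (v u : Ambient d → Ambient d) (p : Ambient d) : Ambient d :=
  surfaceDeriv S u p (v p)

/-- The covariant derivative `∇_v u = P_Σ (v^i ∂_i u)`, i.e. the Levi-Civita connection of `S`
with the metric induced by the Euclidean inner product. -/
def covDeriv (S : Set (Ambient d)) (v u : Ambient d → Ambient d) (p : Ambient d) : Ambient d :=
  tangentProj S p (convect S v u p)

/-- `(u, π)` solves the surface Navier-Stokes equations with viscosity `μ` and density one on `S`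
for all positive times:
`∂_t u + P_Σ (u · ∇_Σ u) - P_Σ div_Σ T_Σ(u, π) = 0` and `div_Σ u = 0` on `S`. -/
def IsSurfaceNavierStokesSolution (μ : ℝ) (S : Set (Ambient d)) (u : ℝ → Ambient d → Ambient d)
    (π : ℝ → Ambient d → ℝ) : Prop :=
  ∀ t : ℝ, 0 < t → ∀ p ∈ S,
    deriv (fun s => u s p) t + tangentProj S p (convect S (u t) (u t) p)
        - tangentProj S p (surfaceDivTensor S (stress μ S (u t) (π t)) p) = 0 ∧
      surfaceDiv S (u t) p = 0

/-- `(u, π)` is an equilibrium, i.e. a time-independent solution, of the surface Navier-Stokes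
equations. -/
def IsEquilibrium (μ : ℝ) (S : Set (Ambient d)) (u : Ambient d → Ambient d)
    (π : Ambient d → ℝ) : Prop :=
  IsSurfaceNavierStokesSolution μ S (fun _ => u) (fun _ => π)

/-- The tangential field `u` is a Killing field of `S`: `(∇_v u | w) + (∇_w u | v) = 0` on `S` for
all tangential fields `v`, `w` on `S`. -/
def IsKillingField (S : Set (Ambient d)) (u : Ambient d → Ambient d) : Prop :=
  ∀ v w : Ambient d → Ambient d, IsTangentialField 1 S v → IsTangentialField 1 S w →
    ∀ p ∈ S, inner ℝ (covDeriv S v u p) (w p) + inner ℝ (covDeriv S w u p) (v p) = 0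

end SurfaceNS

end

/-!
The heart of the matter is that an equilibrium has no strain. Testing the momentum equation with `u`
and using `div u = 0` gives `div (2 μ D(u) u - (|u|² / 2 + π) u) = 2 μ |D(u)|²`
(`IsTangentialField.surfaceDiv_energyFlux`; this uses that `D(u)` is the symmetric part of the
projected differential, and that `div P` is normal because `P² = P`). On a compact surface the
integral of a divergence vanishes, so `D(u) = 0`. Without strain, `P (u · ∇u) = -∇(|u|² / 2)`, so
the momentum equation says `∇π = ∇(|u|² / 2)`, and connectedness gives the constant. The converse
is the same computation read backwards; `div u = tr D(u)` and
`2 (D(u) v | w) = (∇_v u | w) + (∇_w u | v)` on tangent vectors give the remaining claims.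

The divergence theorem is proved without a surface measure, in the form that a tangential `C¹` field
with `div w ≥ 0` on `S` is divergence free (`IsTangentialField.surfaceDiv_eq_zero`). The field is
extended to a `C¹` field `F` of compact support on the ambient space whose differential at the points
of `S` is the surface differential (`IsContDiffOnSurface.exists_normalExtension`): locally, compose
any extension with one Newton step `x ↦ x - ρ ∇ρ / |∇ρ|²` for a defining function `ρ`, whose
differential on `S` is the tangential projection; then glue by a partition of unity. Then `div F` is
`div w` on `S`, and `F` is tangent to the level sets of the distance to `S` up to an error that is
small compared with the distance. Integrating `div F` by parts against the Lipschitz function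
`max 0 (1 - dist(x, S) / ε)` shows that its integral is `o(vol N_ε)`, with `N_ε` the
`ε`-neighbourhood of `S`. Since `vol N_ε = O(ε)`, while the part of `N_ε` in a fixed ball about a
point of `S` has volume at least `c ε`, the divergence cannot be positive anywhere on `S`.

All local facts on `S`, including these volume bounds, rest on `IsGraphNear`: a defining function is
Lipschitz and grows at a positive rate along a fixed direction `ν`, so that lines parallel to `ν`
cross `S` locally at most once, at a point depending on the line in a Lipschitz way. The same fact shows that functions
with vanishing differential are locally constant (`IsSmoothHypersurface.exists_eq_const`).
-/

noncomputable section

namespace SurfaceNS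

open scoped ContDiff Topology Manifold

/-! ### Local structure of a hypersurface -/

section

variable {d : ℕ}

open Metric Set Filter

/-- Quantitative transversality near `p`: on the ball of radius `R` about `p` the set `S` is the
zero set of the `L`-Lipschitz function `ρ`, which grows at least at rate `c` along `ν`. -/
structure IsGraphNear (S : Set (Ambient d)) (ρ : Ambient d → ℝ) (p ν : Ambient d)
    (R c L : ℝ) : Prop where
  radius_pos : 0 < R
  rate_pos : 0 < c
  lip_pos : 0 < L
  norm_eq : ‖ν‖ = 1
  mem_iff : ∀ x ∈ ball p R, x ∈ S ↔ ρ x = 0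
  lip : ∀ x ∈ ball p R, ∀ y ∈ ball p R, |ρ x - ρ y| ≤ L * ‖x - y‖
  growth : ∀ x ∈ ball p R, ∀ t : ℝ, 0 ≤ t → x + t • ν ∈ ball p R → ρ x + c * t ≤ ρ (x + t • ν)

/-- `ρ` is a smooth defining function of `S` on the open set `U`. -/
structure IsDefiningFunction (S : Set (Ambient d)) (U : Set (Ambient d))
    (ρ : Ambient d → ℝ) : Prop where
  isOpen : IsOpen U
  contDiffOn : ContDiffOn ℝ ∞ ρ U
  fderiv_ne : ∀ x ∈ U, fderiv ℝ ρ x ≠ 0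
  inter_eq : S ∩ U = {x ∈ U | ρ x = 0}

variable {S U : Set (Ambient d)} {ρ : Ambient d → ℝ} {p q ν : Ambient d} {R c L : ℝ}

theorem IsSmoothHypersurface.exists_definingFunction (hS : IsSmoothHypersurface S) (hp : p ∈ S) :
    ∃ U ρ, p ∈ U ∧ IsDefiningFunction S U ρ := by
  obtain ⟨U, hU, hpU, ρ, h1, h2, h3⟩ := hS p hp
  exact ⟨U, ρ, hpU, hU, h1, h2, h3⟩

namespace IsDefiningFunction

theorem mem_iff (h : IsDefiningFunction S U ρ) {x : Ambient d} (hx : x ∈ U) :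
    x ∈ S ↔ ρ x = 0 := by
  have := Set.ext_iff.1 h.inter_eq x
  simpa [hx] using this

theorem contDiffAt (h : IsDefiningFunction S U ρ) {x : Ambient d} (hx : x ∈ U) :
    ContDiffAt ℝ ∞ ρ x :=
  h.contDiffOn.contDiffAt (h.isOpen.mem_nhds hx)

theorem differentiableAt (h : IsDefiningFunction S U ρ) {x : Ambient d} (hx : x ∈ U) :
    DifferentiableAt ℝ ρ x :=
  (h.contDiffAt hx).differentiableAt (by simp)

theorem contDiffAt_fderiv (h : IsDefiningFunction S U ρ) {x : Ambient d} (hx : x ∈ U) :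
    ContDiffAt ℝ ∞ (fderiv ℝ ρ) x :=
  (h.contDiffAt hx).fderiv_right (by simp)

theorem exists_isGraphNear (h : IsDefiningFunction S U ρ) (hq : q ∈ U) :
    ∃ ν R c L, ball q R ⊆ U ∧ IsGraphNear S ρ q ν R c L := by
  obtain ⟨v, hv⟩ : ∃ v, fderiv ℝ ρ q v ≠ 0 := by
    by_contra! hcon
    exact h.fderiv_ne q hq (ContinuousLinearMap.ext hcon)
  obtain ⟨ν, hν1, hν⟩ : ∃ ν : Ambient d, ‖ν‖ = 1 ∧ 0 < fderiv ℝ ρ q ν := by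
    have hv0 : v ≠ 0 := by rintro rfl; simp at hv
    have hn : 0 < ‖v‖ := norm_pos_iff.2 hv0
    rcases lt_or_gt_of_ne hv with hlt | hgt
    · refine ⟨-(‖v‖⁻¹ • v), by rw [norm_neg, norm_smul]; simp [hn.ne'], ?_⟩
      simp only [map_neg, map_smul, smul_eq_mul, Left.neg_pos_iff]
      exact mul_neg_of_pos_of_neg (inv_pos.2 hn) hlt
    · refine ⟨‖v‖⁻¹ • v, by rw [norm_smul]; simp [hn.ne'], ?_⟩
      simp only [map_smul, smul_eq_mul]
      positivity
  set c := fderiv ℝ ρ q ν / 2 with hc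
  set L := ‖fderiv ℝ ρ q‖ + 1 with hL
  have hcont : ContinuousAt (fderiv ℝ ρ) q := (h.contDiffAt_fderiv hq).continuousAt
  have e1 : ∀ᶠ x in 𝓝 q, c < fderiv ℝ ρ x ν :=
    (hcont.clm_apply continuousAt_const).eventually_const_lt (by rw [hc]; linarith)
  have e2 : ∀ᶠ x in 𝓝 q, ‖fderiv ℝ ρ x‖ < L :=
    hcont.norm.eventually_lt_const (by rw [hL]; linarith)
  obtain ⟨R, hR, hball⟩ := Metric.eventually_nhds_iff_ball.1
    ((e1.and e2).and (h.isOpen.mem_nhds hq))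
  have hsub : ball q R ⊆ U := fun x hx => (hball x hx).2
  have hLpos : 0 < L := by positivity
  refine ⟨ν, R, c, L, hsub, hR, by positivity, hLpos, hν1, fun x hx => h.mem_iff (hsub hx), ?_, ?_⟩
  · intro x hx y hy
    have := (convex_ball q R).norm_image_sub_le_of_norm_hasFDerivWithin_le (C := L)
      (fun z hz => (h.differentiableAt (hsub hz)).hasFDerivAt.hasFDerivWithinAt)
      (fun z hz => (hball z hz).1.2.le) hy hx
    simpa using this
  · intro x hx t ht hxt
    have hmem : ∀ s ∈ Icc (0 : ℝ) t, x + s • ν ∈ ball q R := by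
      intro s hs
      have := (convex_ball q R).segment_subset hx hxt
      rcases ht.eq_or_lt with rfl | ht'
      · have : s = 0 := le_antisymm hs.2 hs.1
        simpa [this] using hx
      · refine this ?_
        rw [segment_eq_image']
        refine ⟨s / t, ⟨by have := hs.1; positivity, (div_le_one ht').2 hs.2⟩, ?_⟩
        simp only [add_sub_cancel_left, smul_smul]
        field_simp
    have hder : ∀ s ∈ Icc (0 : ℝ) t,
        HasDerivAt (fun s : ℝ => ρ (x + s • ν)) (fderiv ℝ ρ (x + s • ν) ν) s := by
      intro s hs
      have h1 : HasDerivAt (fun s : ℝ => x + s • ν) ν s := by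
        simpa using ((hasDerivAt_id s).smul_const ν).const_add x
      exact (h.differentiableAt (hsub (hmem s hs))).hasFDerivAt.comp_hasDerivAt s h1
    have := (convex_Icc (0 : ℝ) t).mul_sub_le_image_sub_of_le_deriv
      (f := fun s : ℝ => ρ (x + s • ν)) (C := c)
      (fun s hs => (hder s hs).continuousAt.continuousWithinAt)
      (fun s hs => (hder s (interior_subset hs)).differentiableAt.differentiableWithinAt)
      (fun s hs => by
        rw [(hder s (interior_subset hs)).deriv]
        exact (hball _ (hmem s (interior_subset hs))).1.1.le)
      0 (left_mem_Icc.2 ht) t (right_mem_Icc.2 ht) ht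
    simp only [zero_smul, add_zero, sub_zero] at this
    linarith

end IsDefiningFunction

namespace IsGraphNear

theorem continuousOn (h : IsGraphNear S ρ p ν R c L) : ContinuousOn ρ (ball p R) :=
  (LipschitzOnWith.of_dist_le_mul (K := ⟨L, h.lip_pos.le⟩) fun x hx y hy => by
    rw [Real.dist_eq, dist_eq_norm]
    exact h.lip x hx y hy).continuousOn

/-- Two points on a line parallel to `ν` are separated by `ρ`. -/
theorem rate_mul_abs_le (h : IsGraphNear S ρ p ν R c L) {x : Ambient d} {s t : ℝ}
    (hs : x + s • ν ∈ ball p R) (ht : x + t • ν ∈ ball p R) :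
    c * |s - t| ≤ |ρ (x + s • ν) - ρ (x + t • ν)| := by
  wlog hst : t ≤ s generalizing s t
  · rw [abs_sub_comm s, abs_sub_comm (ρ _)]
    exact this ht hs (le_of_not_ge hst)
  have := h.growth _ ht (s - t) (by linarith) (by
    rwa [add_assoc, ← add_smul, add_sub_cancel])
  rw [add_assoc, ← add_smul, add_sub_cancel] at this
  rw [abs_of_nonneg (by linarith : 0 ≤ s - t)]
  exact le_trans (by linarith) (le_abs_self _)

/-- Moving along `ν` one hits `S`, at a distance controlled by `ρ`. -/
theorem exists_add_smul_mem (h : IsGraphNear S ρ p ν R c L) {x : Ambient d}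
    (hx : ‖x - p‖ + |ρ x| / c < R) :
    ∃ t : ℝ, c * |t| ≤ |ρ x| ∧ x + t • ν ∈ ball p R ∧ x + t • ν ∈ S := by
  have hc := h.rate_pos
  set s := |ρ x| / c with hs
  have hs0 : 0 ≤ s := by positivity
  have hcs : c * s = |ρ x| := by rw [hs]; field_simp
  have hmem : ∀ t ∈ Icc (-s) s, x + t • ν ∈ ball p R := by
    intro t ht
    rw [mem_ball_iff_norm]
    calc ‖x + t • ν - p‖ = ‖(x - p) + t • ν‖ := by congr 1; abel
      _ ≤ ‖x - p‖ + ‖t • ν‖ := norm_add_le _ _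
      _ = ‖x - p‖ + |t| := by rw [norm_smul, h.norm_eq, mul_one, Real.norm_eq_abs]
      _ ≤ ‖x - p‖ + s := by gcongr; exact abs_le.2 ht
      _ < R := hx
  have hx0 : x ∈ ball p R := by simpa using hmem 0 ⟨by linarith, hs0⟩
  have hcont : ContinuousOn (fun t : ℝ => ρ (x + t • ν)) (Icc (-s) s) :=
    h.continuousOn.comp (by fun_prop) hmem
  have hright := h.growth x hx0 s hs0 (hmem s ⟨by linarith, le_rfl⟩)
  have hleft := h.growth _ (hmem (-s) ⟨le_rfl, by linarith⟩) s hs0 (by simpa using hx0)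
  have hsimp : x + (-s) • ν + s • ν = x := by simp
  rw [hsimp] at hleft
  obtain ⟨t, ht, h0⟩ := intermediate_value_Icc (by linarith : -s ≤ s) hcont
    (show (0 : ℝ) ∈ Icc (ρ (x + (-s) • ν)) (ρ (x + s • ν)) from
      ⟨by have := le_abs_self (ρ x); linarith, by have := neg_abs_le (ρ x); linarith⟩)
  refine ⟨t, ?_, hmem t ht, (h.mem_iff _ (hmem t ht)).2 h0⟩
  rw [← hcs]
  gcongr
  exact abs_le.2 ht

end IsGraphNear

/-- A kernel vector `v` is a limit of rescaled secants: the point `q + s v` is moved into `S` along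
`ν` by `O(|ρ (q + s v)|) = o(s)`. -/
theorem IsDefiningFunction.tangentSpace_eq (h : IsDefiningFunction S U ρ) (hqU : q ∈ U)
    (hqS : q ∈ S) : tangentSpace S q = (fderiv ℝ ρ q).ker := by
  have hder := (h.differentiableAt hqU).hasFDerivAt
  have hρq : ρ q = 0 := (h.mem_iff hqU).1 hqS
  apply le_antisymm
  · refine Submodule.span_le.2 fun v hv => ?_
    have h0 : HasFDerivWithinAt ρ (0 : Ambient d →L[ℝ] ℝ) S q := by
      refine (hasFDerivWithinAt_const (0 : ℝ) q S).congr_of_eventuallyEq ?_ hρq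
      filter_upwards [self_mem_nhdsWithin, mem_nhdsWithin_of_mem_nhds (h.isOpen.mem_nhds hqU)]
        with x hx hxU using (h.mem_iff hxU).1 hx
    simpa using hder.hasFDerivWithinAt.unique_on h0 hv
  · intro v hv
    refine Submodule.subset_span ?_
    obtain ⟨ν, R, c, L, hsub, hG⟩ := h.exists_isGraphNear hqU
    have hv0 : fderiv ℝ ρ q v = 0 := hv
    have hline : HasDerivAt (fun s : ℝ => ρ (q + s • v)) 0 0 := by
      have h1 : HasDerivAt (fun s : ℝ => q + s • v) v 0 := by
        simpa using ((hasDerivAt_id (0 : ℝ)).smul_const v).const_add q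
      have h2 : HasFDerivAt ρ (fderiv ℝ ρ q) (q + (0 : ℝ) • v) := by simpa using hder
      have h3 := h2.comp_hasDerivAt (0 : ℝ) h1
      rwa [hv0] at h3
    have hlim : Tendsto (fun s : ℝ => q + s • v) (𝓝 0) (𝓝 q) := by
      have : Continuous fun s : ℝ => q + s • v := by fun_prop
      simpa using this.tendsto 0
    have hclose : ∀ᶠ s in 𝓝[>] (0 : ℝ), ‖q + s • v - q‖ + |ρ (q + s • v)| / c < R := by
      refine Filter.Eventually.filter_mono nhdsWithin_le_nhds ?_
      have hc : Tendsto (fun s : ℝ => ‖q + s • v - q‖ + |ρ (q + s • v)| / c) (𝓝 0) (𝓝 0) := by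
        have h1 : ContinuousAt (fun x => ‖x - q‖ + |ρ x| / c) q := by
          have := hder.continuousAt
          fun_prop
        have h2 := h1.tendsto.comp hlim
        simpa [hρq, Function.comp_def] using h2
      exact hc.eventually_lt_const hG.radius_pos
    choose! t ht1 _ ht3 using fun (s : ℝ) (hs : ‖q + s • v - q‖ + |ρ (q + s • v)| / c < R) =>
      hG.exists_add_smul_mem hs
    have hρo : Tendsto (fun s : ℝ => s⁻¹ * ρ (q + s • v)) (𝓝[>] 0) (𝓝 0) := by
      have := hline.tendsto_slope_zero_right
      simpa [hρq] using this
    have hto : Tendsto (fun s : ℝ => s⁻¹ * t s) (𝓝[>] 0) (𝓝 0) := by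
      have hc := hG.rate_pos
      have hb : Tendsto (fun s : ℝ => c⁻¹ * |s⁻¹ * ρ (q + s • v)|) (𝓝[>] 0) (𝓝 0) := by
        simpa using hρo.abs.const_mul c⁻¹
      refine squeeze_zero_norm' ?_ hb
      filter_upwards [hclose] with s hs
      rw [Real.norm_eq_abs, abs_mul, abs_mul]
      have := ht1 s hs
      rw [show c⁻¹ * (|s⁻¹| * |ρ (q + s • v)|) = |s⁻¹| * (c⁻¹ * |ρ (q + s • v)|) by ring]
      gcongr
      rw [inv_mul_eq_div, le_div_iff₀ hc]
      linarith
    have hcd : Tendsto (fun s : ℝ => s⁻¹ • (s • v + t s • ν)) (𝓝[>] 0) (𝓝 v) := by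
      have h1 : Tendsto (fun s : ℝ => v + (s⁻¹ * t s) • ν) (𝓝[>] 0) (𝓝 (v + (0 : ℝ) • ν)) :=
        (hto.smul_const ν).const_add v
      simp only [zero_smul, add_zero] at h1
      refine h1.congr' ?_
      filter_upwards [self_mem_nhdsWithin] with s hs
      have hs' : s ≠ 0 := (mem_Ioi.1 hs).ne'
      rw [smul_add, smul_smul, smul_smul, inv_mul_cancel₀ hs', one_smul]
    refine mem_tangentConeAt_of_seq (𝓝[>] (0 : ℝ)) (fun s => s⁻¹) (fun s => s • v + t s • ν)
      ?_ ?_ hcd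
    · have hid : Tendsto (fun s : ℝ => s) (𝓝[>] 0) (𝓝 0) := nhdsWithin_le_nhds
      have := hid.smul hcd
      rw [zero_smul] at this
      refine this.congr' ?_
      filter_upwards [self_mem_nhdsWithin] with s hs
      have hs' : s ≠ 0 := (mem_Ioi.1 hs).ne'
      rw [smul_smul, mul_inv_cancel₀ hs', one_smul]
    · filter_upwards [hclose] with s hs
      have := ht3 s hs
      rwa [add_assoc] at this

/-- The closed formula `v - (n | v) n / |n|²`, with `n = ∇ρ`, for the projection onto the tangent
space of the level set of `ρ`. -/
def levelProj (ρ : Ambient d → ℝ) (x : Ambient d) : Ambient d →L[ℝ] Ambient d :=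
  ContinuousLinearMap.id ℝ _ -
    (‖gradient ρ x‖ ^ 2)⁻¹ • (fderiv ℝ ρ x).smulRight (gradient ρ x)

namespace IsDefiningFunction

theorem gradient_ne (h : IsDefiningFunction S U ρ) {x : Ambient d} (hx : x ∈ U) :
    gradient ρ x ≠ 0 := by
  simpa [gradient] using h.fderiv_ne x hx

theorem contDiffAt_gradient (h : IsDefiningFunction S U ρ) {x : Ambient d} (hx : x ∈ U) :
    ContDiffAt ℝ ∞ (gradient ρ) x :=
  (InnerProductSpace.toDual ℝ (Ambient d)).symm.contDiff.contDiffAt.comp x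
    (h.contDiffAt_fderiv hx)

theorem contDiffAt_levelProj (h : IsDefiningFunction S U ρ) {x : Ambient d} (hx : x ∈ U) :
    ContDiffAt ℝ ∞ (levelProj ρ) x := by
  have hg := h.contDiffAt_gradient hx
  have hf := h.contDiffAt_fderiv hx
  have hn : ContDiffAt ℝ ∞ (fun x => (‖gradient ρ x‖ ^ 2)⁻¹) x :=
    (hg.norm_sq ℝ).inv (by simpa using h.gradient_ne hx)
  exact contDiffAt_const.sub (hn.smul (hf.smulRight hg))

theorem tangentProj_eq (h : IsDefiningFunction S U ρ) (hqU : q ∈ U) (hqS : q ∈ S) :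
    tangentProj S q = levelProj ρ q := by
  have hinner : ∀ v, fderiv ℝ ρ q v = inner ℝ (gradient ρ q) v := fun v => by
    simp [gradient]
  have hT : tangentSpace S q = (ℝ ∙ gradient ρ q)ᗮ := by
    rw [h.tangentSpace_eq hqU hqS]
    ext v
    rw [Submodule.mem_orthogonal_singleton_iff_inner_right, ← hinner]
    rfl
  ext1 v
  rw [tangentProj]
  simp only [hT]
  rw [Submodule.starProjection_orthogonal_val]
  rw [Submodule.starProjection_singleton, levelProj, sub_apply,
    smul_apply, ContinuousLinearMap.smulRight_apply, hinner, smul_smul,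
    div_eq_inv_mul]
  rfl

end IsDefiningFunction

end

/-! ### Extension of functions on a hypersurface -/

section

variable {d : ℕ}

open Metric Set Filter

variable {S U : Set (Ambient d)} {ρ : Ambient d → ℝ} {p q v : Ambient d}
  {F : Type*} [NormedAddCommGroup F] [NormedSpace ℝ F] {f G : Ambient d → F} {k : ℕ}

theorem tangentProj_mem (S : Set (Ambient d)) (p v : Ambient d) :
    tangentProj S p v ∈ tangentSpace S p :=
  Submodule.starProjection_apply_mem _ _

theorem tangentProj_of_mem (hv : v ∈ tangentSpace S p) : tangentProj S p v = v :=
  Submodule.starProjection_eq_self_iff.2 hv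

theorem tangentProj_tangentProj (S : Set (Ambient d)) (p v : Ambient d) :
    tangentProj S p (tangentProj S p v) = tangentProj S p v :=
  tangentProj_of_mem (tangentProj_mem S p v)

theorem inner_tangentProj_left (S : Set (Ambient d)) (p v w : Ambient d) :
    inner ℝ (tangentProj S p v) w = inner ℝ v (tangentProj S p w) :=
  Submodule.inner_starProjection_left_eq_right _ _ _

theorem surfaceDeriv_tangentProj (S : Set (Ambient d)) (f : Ambient d → F) (p v : Ambient d) :
    surfaceDeriv S f p (tangentProj S p v) = surfaceDeriv S f p v := by
  simp [surfaceDeriv, tangentProj_tangentProj]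

/-- The surface differential can be computed from any differentiable extension. -/
theorem surfaceDeriv_eq {G' : Ambient d →L[ℝ] F} (hG : HasFDerivAt G G' q) (hq : q ∈ S)
    (hGf : ∀ᶠ x in 𝓝[S] q, G x = f x) : surfaceDeriv S f q = G' ∘L tangentProj S q := by
  have h1 : HasFDerivWithinAt f G' S q :=
    hG.hasFDerivWithinAt.congr_of_eventuallyEq (hGf.mono fun x hx => hx.symm)
      (hGf.self_of_nhdsWithin hq).symm
  have h2 := h1.differentiableWithinAt.hasFDerivWithinAt
  have h3 := LinearMap.eqOn_span (f := (fderivWithin ℝ f S q).toLinearMap) (g := G'.toLinearMap)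
    (h2.unique_on h1)
  ext v
  exact h3 (tangentProj_mem S q v)

theorem surfaceDeriv_congr {f g : Ambient d → F} (h : EqOn f g S) (hq : q ∈ S) :
    surfaceDeriv S f q = surfaceDeriv S g q := by
  rw [surfaceDeriv, surfaceDeriv, fderivWithin_congr h (h hq)]

/-- A smooth map fixing the zero set of `ρ`, whose differential at a point of this set is the
projection onto the tangent space: one Newton step towards the zero set. -/
def newtonStep (ρ : Ambient d → ℝ) (x : Ambient d) : Ambient d :=
  x - (ρ x * (‖gradient ρ x‖ ^ 2)⁻¹) • gradient ρ x

theorem IsDefiningFunction.contDiffAt_newtonStep (h : IsDefiningFunction S U ρ) (hq : q ∈ U) :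
    ContDiffAt ℝ ∞ (newtonStep ρ) q := by
  have hg := h.contDiffAt_gradient hq
  have hn : ContDiffAt ℝ ∞ (fun x => (‖gradient ρ x‖ ^ 2)⁻¹) q :=
    (hg.norm_sq ℝ).inv (by simpa using h.gradient_ne hq)
  exact contDiffAt_id.sub (((h.contDiffAt hq).mul hn).smul hg)

theorem IsDefiningFunction.hasFDerivAt_newtonStep (h : IsDefiningFunction S U ρ) (hq : q ∈ U)
    (hqS : q ∈ S) : HasFDerivAt (newtonStep ρ) (tangentProj S q) q := by
  have hρq : ρ q = 0 := (h.mem_iff hq).1 hqS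
  have hg := h.contDiffAt_gradient hq
  have hn : ContDiffAt ℝ ∞ (fun x => (‖gradient ρ x‖ ^ 2)⁻¹) q :=
    (hg.norm_sq ℝ).inv (by simpa using h.gradient_ne hq)
  have h1 := ((h.differentiableAt hq).hasFDerivAt.mul
    (hn.differentiableAt (by simp)).hasFDerivAt).smul (hg.differentiableAt (by simp)).hasFDerivAt
  refine ((hasFDerivAt_id q).sub h1).congr_fderiv ?_
  rw [h.tangentProj_eq hq hqS]
  ext1 v
  simp [levelProj, hρq, smul_smul]

/-- Near a point of `S`, a `C^k` function on `S` has a `C^k` extension whose differential at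
the points of `S` is the surface differential. -/
theorem IsSmoothHypersurface.exists_local_extension (hS : IsSmoothHypersurface S) (hk : 1 ≤ k)
    (hf : IsContDiffOnSurface k S f) (hp : p ∈ S) :
    ∃ V : Set (Ambient d), IsOpen V ∧ p ∈ V ∧ ∃ g : Ambient d → F, (∀ x ∈ V, ContDiffAt ℝ k g x) ∧
      ∀ q ∈ S, q ∈ V → g q = f q ∧ HasFDerivAt g (surfaceDeriv S f q) q := by
  obtain ⟨U, ρ, hpU, h⟩ := hS.exists_definingFunction hp
  obtain ⟨g, hg, hgf⟩ := hf p hp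
  have hfix : ∀ q ∈ S, q ∈ U → newtonStep ρ q = q := fun q hq hqU => by
    simp [newtonStep, (h.mem_iff hqU).1 hq]
  obtain ⟨W, hWsub, hWo, hpW⟩ := _root_.eventually_nhds_iff.1
    ((hg.eventually (by simp)).and (eventually_nhdsWithin_iff.1 hgf))
  have hcont : ContinuousOn (newtonStep ρ) U := fun x hx =>
    (h.contDiffAt_newtonStep hx).continuousAt.continuousWithinAt
  refine ⟨W ∩ (U ∩ newtonStep ρ ⁻¹' W), hWo.inter (hcont.isOpen_inter_preimage h.isOpen hWo),
    ⟨hpW, hpU, by simpa [hfix p hp hpU] using hpW⟩, g ∘ newtonStep ρ, ?_, ?_⟩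
  · rintro x ⟨-, hxU, hxW⟩
    exact (hWsub _ hxW).1.comp x ((h.contDiffAt_newtonStep hxU).of_le (by exact_mod_cast le_top))
  · rintro q hq ⟨hqW, hqU, -⟩
    refine ⟨by simp [hfix q hq hqU, (hWsub q hqW).2 hq], ?_⟩
    have hd : HasFDerivAt g (fderiv ℝ g q) q :=
      ((hWsub q hqW).1.differentiableAt (by
        simpa using Nat.one_le_iff_ne_zero.1 hk)).hasFDerivAt
    rw [surfaceDeriv_eq hd hq (by
      filter_upwards [self_mem_nhdsWithin, mem_nhdsWithin_of_mem_nhds (hWo.mem_nhds hqW)]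
        with x hx hxW using (hWsub x hxW).2 hx)]
    have hd' : HasFDerivAt g (fderiv ℝ g q) (newtonStep ρ q) := by rwa [hfix q hq hqU]
    exact hd'.comp q (h.hasFDerivAt_newtonStep hqU hq)

/-- `G` is a `C^k` extension of `f : S → F` to the ambient space, whose differential vanishes in
the directions normal to `S`. -/
structure IsNormalExtension (k : ℕ) (S : Set (Ambient d)) (f G : Ambient d → F) : Prop where
  contDiff : ContDiff ℝ k G
  eqOn : EqOn G f S
  hasFDerivAt : ∀ q ∈ S, HasFDerivAt G (surfaceDeriv S f q) q

/-- Extensions as in `IsNormalExtension` form a convex set, so local ones are glued by a partition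
of unity. -/
theorem IsContDiffOnSurface.exists_normalExtension (hf : IsContDiffOnSurface k S f)
    (hS : IsSmoothHypersurface S) (hc : IsClosed S) (hk : 1 ≤ k) :
    ∃ G, IsNormalExtension k S f G := by
  have hloc : ∀ i : Ambient d, ∃ V : Set (Ambient d), IsOpen V ∧ i ∈ V ∧
      ∃ g : Ambient d → F, (∀ x ∈ V, ContDiffAt ℝ k g x) ∧
      ∀ q ∈ S, q ∈ V → g q = f q ∧ HasFDerivAt g (surfaceDeriv S f q) q := by
    intro i
    by_cases hi : i ∈ S
    · exact hS.exists_local_extension hk hf hi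
    · exact ⟨Sᶜ, hc.isOpen_compl, hi, 0, fun x _ => contDiffAt_const,
        fun q hq hq' => absurd hq hq'⟩
  choose V hVo hV g hg hgS using hloc
  obtain ⟨χ, hχ⟩ := SmoothPartitionOfUnity.exists_isSubordinate 𝓘(ℝ, Ambient d) isClosed_univ V hVo
    (fun x _ => mem_iUnion.2 ⟨x, hV x⟩)
  set G : Ambient d → F := fun x => ∑ᶠ i, χ i x • g i x with hG
  have hsum : ∀ x, ∀ t : Set F, Convex ℝ t → (∀ i, χ i x ≠ 0 → g i x ∈ t) → G x ∈ t :=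
    fun x t ht h => χ.finsum_smul_mem_convex (mem_univ x) h ht
  have hEq : EqOn G f S := by
    intro q hq
    refine hsum q {f q} (convex_singleton _) fun i hi => ?_
    exact (hgS i q hq (hχ i (subset_tsupport _ hi))).1
  refine ⟨G, ?_, hEq, fun q hq => ?_⟩
  · refine contDiff_iff_contDiffAt.2 fun x => χ.contDiffAt_finsum fun i hi => ?_
    exact hg i x (hχ i hi)
  · rw [hasFDerivAt_iff_isLittleO, Asymptotics.isLittleO_iff]
    intro C hC
    have hfin : ∀ i ∈ χ.fintsupport q, ∀ᶠ x in 𝓝 q,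
        ‖g i x - f q - surfaceDeriv S f q (x - q)‖ ≤ C * ‖x - q‖ := by
      intro i hi
      obtain ⟨h1, h2⟩ := hgS i q hq (hχ i ((χ.mem_fintsupport_iff q i).1 hi))
      rw [hasFDerivAt_iff_isLittleO, Asymptotics.isLittleO_iff] at h2
      simpa [h1] using h2 hC
    filter_upwards [(Filter.eventually_all_finset _).2 hfin, χ.eventually_finsupport_subset q]
      with x hx hsub
    rw [hEq hq]
    -- the Taylor estimate at `x` says that `g i x` lies in a fixed ball, which is convex
    have hconv : Convex ℝ (closedBall (f q + surfaceDeriv S f q (x - q)) (C * ‖x - q‖)) :=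
      convex_closedBall _ _
    have := hsum x _ hconv fun i hi => by
      rw [mem_closedBall_iff_norm, ← sub_sub]
      exact hx i (hsub ((χ.mem_finsupport x).2 hi))
    rwa [mem_closedBall_iff_norm, ← sub_sub] at this

theorem ContDiff.isContDiffOnSurface {G : Ambient d → F} (hG : ContDiff ℝ k G)
    (h : EqOn G f S) : IsContDiffOnSurface k S f := fun p _ =>
  ⟨G, hG.contDiffAt, by filter_upwards [self_mem_nhdsWithin] with x hx using h hx⟩

theorem IsContDiffOnSurface.of_le {m : ℕ} (hf : IsContDiffOnSurface k S f) (h : m ≤ k) :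
    IsContDiffOnSurface m S f := fun p hp => by
  obtain ⟨g, hg, hgf⟩ := hf p hp
  exact ⟨g, hg.of_le (by exact_mod_cast h), hgf⟩

theorem IsSmoothHypersurface.isContDiffOnSurface_tangentProj (hS : IsSmoothHypersurface S)
    (k : ℕ) : IsContDiffOnSurface k S (tangentProj S) := fun p hp => by
  obtain ⟨U, ρ, hpU, h⟩ := hS.exists_definingFunction hp
  refine ⟨levelProj ρ, (h.contDiffAt_levelProj hpU).of_le (by exact_mod_cast le_top), ?_⟩
  filter_upwards [self_mem_nhdsWithin, mem_nhdsWithin_of_mem_nhds (h.isOpen.mem_nhds hpU)]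
    with x hx hxU using (h.tangentProj_eq hxU hx).symm

end

/-! ### Volume of thin neighbourhoods -/

section

variable {d : ℕ}

open Metric Set Filter MeasureTheory

variable {S U : Set (Ambient d)} {ρ : Ambient d → ℝ} {p q ν : Ambient d} {R c L : ℝ}

/-- The translates by multiples of `3 L ε / c` along `ν` of the `ε`-neighbourhood of a graph are
disjoint, so that about `1 / ε` copies of it fit into a ball. -/
theorem IsGraphNear.volume_thickening_le (h : IsGraphNear S ρ p ν R c L) :
    ∃ C : ℝ, ∀ᶠ ε in 𝓝[>] (0 : ℝ),
      volume.real (thickening ε S ∩ ball p (R / 2)) ≤ C * ε := by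
  have hR := h.radius_pos
  have hc := h.rate_pos
  have hL := h.lip_pos
  set V := volume.real (ball p R) with hV
  refine ⟨6 * L / (c * R) * V, ?_⟩
  filter_upwards [self_mem_nhdsWithin,
    mem_nhdsWithin_of_mem_nhds (Iio_mem_nhds (half_pos hR))] with ε hε hεR
  rw [mem_Ioi] at hε
  rw [mem_Iio] at hεR
  set A := thickening ε S ∩ ball p (R / 2) with hA
  have hAm : MeasurableSet A := isOpen_thickening.measurableSet.inter measurableSet_ball
  have hAR : A ⊆ ball p R := inter_subset_right.trans (ball_subset_ball (by linarith))
  have hρ : ∀ x ∈ A, |ρ x| ≤ L * ε := by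
    intro x hx
    obtain ⟨z, hz, hxz⟩ := mem_thickening_iff.1 hx.1
    have hzR : z ∈ ball p R := by
      have := mem_ball.1 hx.2
      have h3 := dist_triangle z x p
      rw [dist_comm z x] at h3
      exact mem_ball.2 (by linarith)
    have h0 := (h.mem_iff z hzR).1 hz
    have := h.lip x (hAR hx) z hzR
    rw [h0, sub_zero, ← dist_eq_norm] at this
    exact this.trans (by gcongr)
  set τ := 3 * L * ε / c with hτ
  have hτ0 : 0 < τ := by positivity
  have hcτ : c * τ = 3 * L * ε := by rw [hτ]; field_simp
  set m := ⌈R / (2 * τ)⌉₊ with hm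
  set T : ℕ → Set (Ambient d) := fun j => (fun x => x + (-(j * τ)) • ν) ⁻¹' A with hT
  have hTvol : ∀ j, volume (T j) = volume A := fun j => measure_preimage_add_right _ _ _
  have hTm : ∀ j, MeasurableSet (T j) := fun j => hAm.preimage (by fun_prop)
  have hdisj : Pairwise (Function.onFun Disjoint T) := by
    intro i j hij
    refine Set.disjoint_left.2 fun x hxi hxj => ?_
    have h1 := h.rate_mul_abs_le (hAR hxi) (hAR hxj)
    have h2 := abs_sub (ρ (x + (-(i * τ)) • ν)) (ρ (x + (-(j * τ)) • ν))
    have h3 := hρ _ hxi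
    have h4 := hρ _ hxj
    have h5 : τ ≤ |-(i * τ) - -(j * τ)| := by
      rw [show -(i * τ) - -(j * τ) = (((j : ℤ) - (i : ℤ) : ℤ) : ℝ) * τ by push_cast; ring,
        abs_mul, abs_of_pos hτ0]
      have : (1 : ℝ) ≤ |(((j : ℤ) - (i : ℤ) : ℤ) : ℝ)| := by
        rw [← Int.cast_abs]
        have hne : (j : ℤ) - (i : ℤ) ≠ 0 := by omega
        exact_mod_cast Int.one_le_abs hne
      nlinarith
    have h6 : c * τ ≤ c * |-(i * τ) - -(j * τ)| := by gcongr
    have : 0 < L * ε := by positivity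
    linarith
  have hsub : (⋃ j ∈ Finset.range m, T j) ⊆ ball p R := by
    intro x hx
    simp only [mem_iUnion, Finset.mem_range] at hx
    obtain ⟨j, hj, hxj⟩ := hx
    have hxj' := mem_ball_iff_norm.1 hxj.2
    have hjle : (j : ℝ) * τ ≤ R / 2 := by
      have := Nat.lt_ceil.1 hj
      rw [lt_div_iff₀ (by positivity)] at this
      linarith
    rw [mem_ball_iff_norm]
    calc ‖x - p‖ = ‖(x + (-(j * τ)) • ν - p) + (j * τ) • ν‖ := by
          congr 1; rw [neg_smul]; abel
      _ ≤ ‖x + (-(j * τ)) • ν - p‖ + ‖(j * τ) • ν‖ := norm_add_le _ _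
      _ = ‖x + (-(j * τ)) • ν - p‖ + j * τ := by
          rw [norm_smul, h.norm_eq, mul_one, Real.norm_of_nonneg (by positivity)]
      _ < R := by linarith
  have hle : (m : ℝ) * volume.real A ≤ V := by
    have h1 : volume.real (⋃ j ∈ Finset.range m, T j) = ∑ j ∈ Finset.range m, volume.real (T j) :=
      measureReal_biUnion_finset (fun i _ j _ hij => hdisj hij) (fun j _ => hTm j)
        (fun j _ => by
          rw [hTvol]; exact ((measure_mono hAR).trans_lt measure_ball_lt_top).ne)
    have h2 : ∀ j, volume.real (T j) = volume.real A := fun j => by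
      rw [measureReal_def, hTvol, measureReal_def]
    simp only [h2, Finset.sum_const, Finset.card_range, nsmul_eq_mul] at h1
    rw [← h1]
    exact measureReal_mono hsub measure_ball_lt_top.ne
  have hmR : R / (2 * τ) ≤ m := Nat.le_ceil _
  have hA0 : 0 ≤ volume.real A := measureReal_nonneg
  have h7 : R / (2 * τ) * volume.real A ≤ V := (by gcongr : _ ≤ _).trans hle
  have h8 : volume.real A ≤ V * (2 * τ) / R := by
    rw [le_div_iff₀ hR]
    rw [div_mul_eq_mul_div, div_le_iff₀ (by positivity)] at h7
    linarith
  refine h8.trans (le_of_eq ?_)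
  rw [hτ]
  field_simp
  ring

theorem IsSmoothHypersurface.volume_thickening_le (hS : IsSmoothHypersurface S)
    (hc : IsCompact S) :
    ∃ C : ℝ, ∀ᶠ ε in 𝓝[>] (0 : ℝ), volume.real (thickening ε S) ≤ C * ε := by
  have hloc : ∀ p ∈ S, ∃ r > 0, ∃ C : ℝ, ∀ᶠ ε in 𝓝[>] (0 : ℝ),
      volume.real (thickening ε S ∩ ball p r) ≤ C * ε := by
    intro p hp
    obtain ⟨U, ρ, hpU, h⟩ := hS.exists_definingFunction hp
    obtain ⟨ν, R, c, L, -, hG⟩ := h.exists_isGraphNear hpU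
    exact ⟨R / 2, half_pos hG.radius_pos, hG.volume_thickening_le⟩
  choose! r hr C hC using hloc
  obtain ⟨t, htS, ht⟩ := hc.elim_nhds_subcover (fun p => ball p (r p))
    (fun p hp => ball_mem_nhds p (hr p hp))
  obtain ⟨δ, hδ, hsub⟩ := hc.exists_thickening_subset_open
    (isOpen_biUnion fun p (_ : p ∈ t) => isOpen_ball (x := p) (ε := r p)) ht
  refine ⟨∑ p ∈ t, C p, ?_⟩
  filter_upwards [(Filter.eventually_all_finset t).2 fun p hp => hC p (htS p hp),
    mem_nhdsWithin_of_mem_nhds (Iio_mem_nhds hδ)] with ε hε hεδ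
  have hcover : thickening ε S ⊆ ⋃ p ∈ t, (thickening ε S ∩ ball p (r p)) := by
    intro x hx
    have := hsub (thickening_mono (mem_Iio.1 hεδ).le _ hx)
    simp only [mem_iUnion] at this ⊢
    obtain ⟨p, hp, hxp⟩ := this
    exact ⟨p, hp, hx, hxp⟩
  calc volume.real (thickening ε S)
      ≤ volume.real (⋃ p ∈ t, (thickening ε S ∩ ball p (r p))) := by
        refine measureReal_mono hcover ?_
        refine ((measure_biUnion_finset_le _ _).trans_lt ?_).ne
        exact ENNReal.sum_lt_top.2 fun p _ =>
          (measure_mono inter_subset_right).trans_lt measure_ball_lt_top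
    _ ≤ ∑ p ∈ t, volume.real (thickening ε S ∩ ball p (r p)) := measureReal_biUnion_finset_le _ _
    _ ≤ ∑ p ∈ t, C p * ε := Finset.sum_le_sum fun p hp => hε p hp
    _ = (∑ p ∈ t, C p) * ε := (Finset.sum_mul _ _ _).symm

/-- About `1 / ε` translates along `ν` of the `ε`-neighbourhood of a graph cover a small ball. -/
theorem IsSmoothHypersurface.le_volume_thickening (hS : IsSmoothHypersurface S) (hp : p ∈ S)
    {r : ℝ} (hr : 0 < r) :
    ∃ C > 0, ∀ᶠ ε in 𝓝[>] (0 : ℝ), C * ε ≤ volume.real (thickening ε S ∩ ball p r) := by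
  obtain ⟨U, ρ, hpU, hU⟩ := hS.exists_definingFunction hp
  obtain ⟨ν, R, c, L, -, h⟩ := hU.exists_isGraphNear hpU
  have hR := h.radius_pos
  have hc := h.rate_pos
  have hL := h.lip_pos
  -- small enough for the lines along `ν` through the `δ`-ball to meet `S` within `r` and `R`
  obtain ⟨δ, hδ, hδr, hδR⟩ : ∃ δ > 0, δ + L * δ / c < r ∧ δ + L * δ / c < R := by
    have : Tendsto (fun δ : ℝ => δ + L * δ / c) (𝓝[>] 0) (𝓝 0) := by
      have h1 : Continuous fun δ : ℝ => δ + L * δ / c := by fun_prop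
      have := h1.tendsto 0
      simp only [mul_zero, zero_div, add_zero] at this
      exact this.mono_left nhdsWithin_le_nhds
    obtain ⟨δ, h1, h2, h3⟩ := ((this.eventually_lt_const hr).and
      ((this.eventually_lt_const hR).and self_mem_nhdsWithin)).exists
    exact ⟨δ, h3, h1, h2⟩
  have hLc : 0 < L * δ / c := by positivity
  set V := volume.real (ball p δ) with hV
  have hV0 : 0 < V := ENNReal.toReal_pos (measure_ball_pos _ _ hδ).ne' measure_ball_lt_top.ne
  set K := 2 * (L * δ / c) + 5 with hK
  have hK0 : 0 < K := by positivity
  refine ⟨V / (2 * K), by positivity, ?_⟩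
  filter_upwards [self_mem_nhdsWithin,
    mem_nhdsWithin_of_mem_nhds (Iio_mem_nhds (sub_pos.2 hδr)),
    mem_nhdsWithin_of_mem_nhds (Iio_mem_nhds one_pos)] with ε hε hεr hε1
  rw [mem_Ioi] at hε
  rw [mem_Iio] at hεr hε1
  set A := thickening ε S ∩ ball p r with hA
  set τ := ε / 2 with hτ
  have hτ0 : 0 < τ := by positivity
  set m : ℕ := ⌈L * δ / c / τ⌉₊ + 1 with hm
  set T : ℤ → Set (Ambient d) := fun j => (fun x => x + (j * τ) • ν) ⁻¹' A with hT
  have hTvol : ∀ j, volume (T j) = volume A := fun j => measure_preimage_add_right _ _ _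
  have hAfin : volume A ≠ ⊤ := ((measure_mono inter_subset_right).trans_lt measure_ball_lt_top).ne
  have hcover : ball p δ ⊆ ⋃ j ∈ Finset.Icc (-(m : ℤ)) m, T j := by
    intro x hx
    have hxδ := mem_ball_iff_norm.1 hx
    have hδR' : δ < R := by linarith
    have hxR : x ∈ ball p R := ball_subset_ball hδR'.le hx
    have hρx : |ρ x| ≤ L * δ := by
      have h0 := (h.mem_iff p (mem_ball_self hR)).1 hp
      have := h.lip x hxR p (mem_ball_self hR)
      rw [h0, sub_zero] at this
      exact this.trans (by gcongr)
    obtain ⟨t, ht, -, htS⟩ := h.exists_add_smul_mem (x := x) (by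
      calc ‖x - p‖ + |ρ x| / c ≤ δ + L * δ / c := by gcongr
        _ < R := hδR)
    have htle : |t| ≤ L * δ / c := by
      rw [le_div_iff₀ hc]; linarith
    set j := ⌊t / τ⌋ with hj
    have hj1 : (j : ℝ) * τ ≤ t := (le_div_iff₀ hτ0).1 (Int.floor_le _)
    have hj2 : t < (j : ℝ) * τ + τ := by
      have := (div_lt_iff₀ hτ0).1 (Int.lt_floor_add_one (t / τ))
      linarith
    have hjm : |t / τ| ≤ L * δ / c / τ := by
      rw [abs_div, abs_of_pos hτ0]; gcongr
    have hceil : L * δ / c / τ ≤ (⌈L * δ / c / τ⌉₊ : ℝ) := Nat.le_ceil _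
    have hjlo : -(m : ℤ) ≤ j := by
      refine Int.le_floor.2 ?_
      push_cast [hm]
      linarith [(abs_le.1 hjm).1]
    have hjhi : j ≤ m := by
      have : (j : ℝ) ≤ m := (Int.floor_le _).trans (by
        push_cast [hm]
        linarith [(abs_le.1 hjm).2])
      exact_mod_cast this
    simp only [mem_iUnion, Finset.mem_Icc]
    refine ⟨j, ⟨hjlo, hjhi⟩, ?_, ?_⟩
    · refine mem_thickening_iff.2 ⟨_, htS, ?_⟩
      rw [dist_eq_norm, add_sub_add_left_eq_sub, ← sub_smul, norm_smul, h.norm_eq, mul_one,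
        Real.norm_eq_abs, abs_lt]
      constructor <;> linarith
    · rw [mem_ball_iff_norm]
      have habs : |(j : ℝ) * τ| ≤ L * δ / c + τ := by
        have := abs_le.1 htle
        rw [abs_le]
        constructor <;> linarith
      calc ‖x + (j * τ) • ν - p‖ = ‖(x - p) + (j * τ) • ν‖ := by congr 1; abel
        _ ≤ ‖x - p‖ + ‖(j * τ) • ν‖ := norm_add_le _ _
        _ = ‖x - p‖ + |j * τ| := by rw [norm_smul, h.norm_eq, mul_one, Real.norm_eq_abs]
        _ < r := by linarith
  have hle : V ≤ (2 * m + 1) * volume.real A := by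
    have hfin : volume (⋃ j ∈ Finset.Icc (-(m : ℤ)) m, T j) ≠ ⊤ := by
      refine ((measure_biUnion_finset_le _ _).trans_lt ?_).ne
      exact ENNReal.sum_lt_top.2 fun j _ => by rw [hTvol]; exact hAfin.lt_top
    have h2 : ∀ j, volume.real (T j) = volume.real A := fun j => by
      rw [measureReal_def, hTvol, measureReal_def]
    have h1 := (measureReal_mono (μ := volume) hcover hfin).trans
      (measureReal_biUnion_finset_le _ _)
    simp only [h2, Finset.sum_const, Int.card_Icc, nsmul_eq_mul] at h1
    have h3 : (((m : ℤ) + 1 - -(m : ℤ)).toNat : ℝ) = 2 * m + 1 := by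
      have : ((m : ℤ) + 1 - -(m : ℤ)).toNat = 2 * m + 1 := by omega
      rw [this]; push_cast; ring
    rwa [h3] at h1
  have hmle : (2 * m + 1 : ℝ) ≤ K / τ := by
    have h1 : (⌈L * δ / c / τ⌉₊ : ℝ) < L * δ / c / τ + 1 := Nat.ceil_lt_add_one (by positivity)
    rw [le_div_iff₀ hτ0]
    push_cast [hm]
    have h2 : L * δ / c / τ * τ = L * δ / c := by field_simp
    nlinarith
  have hA0 : 0 ≤ volume.real A := measureReal_nonneg
  have h9 : V ≤ K / τ * volume.real A := hle.trans (by gcongr)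
  rw [div_mul_eq_mul_div, le_div_iff₀ hτ0] at h9
  rw [div_mul_eq_mul_div, div_le_iff₀ (by positivity), show V * ε = 2 * (V * τ) by rw [hτ]; ring]
  linarith

end

/-! ### The divergence theorem -/

section

variable {d : ℕ}

open Metric Set Filter MeasureTheory

variable {S U : Set (Ambient d)} {ρ : Ambient d → ℝ} {p q x v w : Ambient d} {ε η : ℝ}

theorem trace_eq_sum_inner (A : Ambient d →L[ℝ] Ambient d) :
    LinearMap.trace ℝ (Ambient d) A.toLinearMap = ∑ k : Fin (d + 1),
      inner ℝ (EuclideanSpace.single k (1 : ℝ)) (A (EuclideanSpace.single k (1 : ℝ))) := by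
  rw [LinearMap.trace_eq_sum_inner _ (EuclideanSpace.basisFun (Fin (d + 1)) ℝ)]
  simp

/-- A segment from a point to a nearest point of `S` is normal to `S`. -/
theorem IsSmoothHypersurface.tangentProj_sub_nearest (hS : IsSmoothHypersurface S) (hp : p ∈ S)
    (hmin : ∀ q ∈ S, dist x p ≤ dist x q) : tangentProj S p (x - p) = 0 := by
  obtain ⟨U, ρ, hpU, h⟩ := hS.exists_definingFunction hp
  have hρp : ρ p = 0 := (h.mem_iff hpU).1 hp
  have hstrict : HasStrictFDerivAt ρ (fderiv ℝ ρ p) p :=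
    (h.contDiffAt hpU).hasStrictFDerivAt (by simp)
  have hφ : HasStrictFDerivAt (fun y : Ambient d => ‖x - y‖ ^ 2)
      (2 • (innerSL ℝ (x - p)).comp (-ContinuousLinearMap.id ℝ (Ambient d))) p :=
    (hasStrictFDerivAt_norm_sq (x - p)).comp p ((hasStrictFDerivAt_id p).const_sub x)
  have hloc : IsLocalExtrOn (fun y : Ambient d => ‖x - y‖ ^ 2) {y | ρ y = ρ p} p := by
    left
    have : ∀ᶠ y in 𝓝[{y | ρ y = ρ p}] p, ‖x - p‖ ^ 2 ≤ ‖x - y‖ ^ 2 := by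
      filter_upwards [self_mem_nhdsWithin, mem_nhdsWithin_of_mem_nhds (h.isOpen.mem_nhds hpU)]
        with y hy hyU
      have := hmin y ((h.mem_iff hyU).2 (by rw [← hρp]; exact hy))
      rw [dist_eq_norm, dist_eq_norm] at this
      gcongr
    exact this
  obtain ⟨a, b, hab, h0⟩ := hloc.exists_multipliers_of_hasStrictFDerivAt_1d hstrict hφ
  have hb : b ≠ 0 := by
    rintro rfl
    have ha : a ≠ 0 := by simpa using hab
    simp only [zero_smul, add_zero, smul_eq_zero, ha, false_or] at h0
    exact h.fderiv_ne p hpU h0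
  have horth : ∀ v ∈ tangentSpace S p, inner ℝ (x - p) v = 0 := by
    intro v hv
    rw [h.tangentSpace_eq hpU hp] at hv
    have hv0 : fderiv ℝ ρ p v = 0 := hv
    have := DFunLike.congr_fun h0 v
    have h1 : a * fderiv ℝ ρ p v + b * (2 * -inner ℝ (x - p) v) = 0 := by
      simpa only [add_apply, smul_apply, ContinuousLinearMap.comp_apply, neg_apply,
        ContinuousLinearMap.id_apply, innerSL_apply_apply, inner_neg_right, zero_apply,
        smul_eq_mul, nsmul_eq_mul, Nat.cast_ofNat] using this
    rw [hv0, mul_zero, zero_add, mul_eq_zero] at h1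
    linarith [h1.resolve_left hb]
  have h1 := inner_tangentProj_left S p (x - p) (tangentProj S p (x - p))
  rw [tangentProj_tangentProj, horth _ (tangentProj_mem S p _)] at h1
  exact inner_self_eq_zero.1 h1

/-- The Lipschitz function which is `1` on `S`, vanishes at distance `ε` from `S`, and is affine in
the distance in between. -/
def collar (S : Set (Ambient d)) (ε : ℝ) (x : Ambient d) : ℝ :=
  max 0 (1 - ε⁻¹ * infDist x S)

theorem collar_nonneg (S : Set (Ambient d)) (ε : ℝ) (x : Ambient d) : 0 ≤ collar S ε x :=
  le_max_left _ _

theorem collar_le_one (hε : 0 < ε) (x : Ambient d) : collar S ε x ≤ 1 := by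
  have : 0 ≤ ε⁻¹ * infDist x S := mul_nonneg (by positivity) infDist_nonneg
  exact max_le zero_le_one (by linarith)

theorem collar_eq_zero (hε : 0 < ε) (hx : ε ≤ infDist x S) : collar S ε x = 0 := by
  refine max_eq_left ?_
  have : ε⁻¹ * ε ≤ ε⁻¹ * infDist x S := by gcongr
  rw [inv_mul_cancel₀ hε.ne'] at this
  linarith

theorem half_le_collar (hε : 0 < ε) (hx : infDist x S ≤ ε / 2) : 1 / 2 ≤ collar S ε x := by
  refine le_max_of_le_right ?_
  have : ε⁻¹ * infDist x S ≤ ε⁻¹ * (ε / 2) := by gcongr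
  have h2 : ε⁻¹ * (ε / 2) = 1 / 2 := by field_simp
  linarith

theorem lipschitzWith_collar (S : Set (Ambient d)) (ε : ℝ) :
    ∃ K, LipschitzWith K (collar S ε) := by
  have h1 : LipschitzWith (‖ε⁻¹‖₊ * 1) fun x => ε⁻¹ * infDist x S :=
    (lipschitzWith_smul ε⁻¹).comp (lipschitz_infDist_pt S)
  exact ⟨_, ((LipschitzWith.const (1 : ℝ)).sub h1).const_max 0⟩

/-- Where it is differentiable, the collar function decreases along the segment from a nearest
point `p` of `S`, and is constant in the orthogonal directions. -/
theorem abs_fderiv_collar_le (hε : 0 < ε) (hp : p ∈ S) (hxp : infDist x S = dist x p)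
    (hd : DifferentiableAt ℝ (collar S ε) x) (hv : |inner ℝ (x - p) v| ≤ η * ‖x - p‖ ^ 2)
    (hη : 0 ≤ η) :
    |fderiv ℝ (collar S ε) x v| ≤ (thickening ε S).indicator (fun _ => η) x := by
  have hne : S.Nonempty := ⟨p, hp⟩
  by_cases hx : x ∈ thickening ε S
  swap
  · rw [indicator_of_notMem hx]
    have hge : ε ≤ infDist x S := by
      by_contra! hlt
      exact hx (mem_thickening_iff.2 ((infDist_lt_iff hne).1 hlt))
    have hmin : IsLocalMin (collar S ε) x := .of_forall fun y => by
      rw [collar_eq_zero hε hge]; exact collar_nonneg _ _ _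
    simp [hmin.fderiv_eq_zero]
  rw [indicator_of_mem hx]
  have hlt : dist x p < ε := by
    rw [← hxp]; exact (infDist_lt_iff hne).2 (mem_thickening_iff.1 hx)
  rw [dist_eq_norm] at hlt hxp
  by_cases hxpe : x - p = 0
  · have hmax : IsLocalMax (collar S ε) x := .of_forall fun y => by
      refine (collar_le_one hε y).trans (le_max_of_le_right ?_)
      rw [hxp, hxpe]; simp
    simpa [hmax.fderiv_eq_zero] using hη
  have hn : 0 < ‖x - p‖ := norm_pos_iff.2 hxpe
  -- `collar` lies above the cone with apex `p` and touches it at `x`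
  have hcone : HasFDerivAt (fun y => 1 - ε⁻¹ * ‖y - p‖)
      (-(ε⁻¹ • (‖x - p‖⁻¹ • innerSL ℝ (x - p)))) x := by
    have h1 : HasFDerivAt (fun y => ‖y - p‖) (‖x - p‖⁻¹ • innerSL ℝ (x - p)) x := by
      have h2 := (((hasFDerivAt_id x).sub_const p).norm_sq).sqrt (by positivity)
      simp only [id, Real.sqrt_sq (norm_nonneg _)] at h2
      refine h2.congr_fderiv ?_
      ext v
      simp
      field_simp
    exact (h1.const_mul ε⁻¹).const_sub 1
  have hmin : IsLocalMin (fun y => collar S ε y - (1 - ε⁻¹ * ‖y - p‖)) x := by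
    refine .of_forall fun y => ?_
    have hx0 : collar S ε x = 1 - ε⁻¹ * ‖x - p‖ := by
      rw [collar, hxp, max_eq_right]
      have : ε⁻¹ * ‖x - p‖ ≤ ε⁻¹ * ε := by gcongr
      rw [inv_mul_cancel₀ hε.ne'] at this
      linarith
    have hy : infDist y S ≤ ‖y - p‖ := by
      rw [← dist_eq_norm]; exact infDist_le_dist_of_mem hp
    have hy2 : 1 - ε⁻¹ * infDist y S ≤ collar S ε y := le_max_right _ _
    have hy3 : ε⁻¹ * infDist y S ≤ ε⁻¹ * ‖y - p‖ := by gcongr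
    simp only [hx0, sub_self]
    linarith
  have hzero := hmin.hasFDerivAt_eq_zero (hd.hasFDerivAt.sub hcone)
  have hval : fderiv ℝ (collar S ε) x v = -(ε⁻¹ * (‖x - p‖⁻¹ * inner ℝ (x - p) v)) := by
    have := DFunLike.congr_fun hzero v
    simp only [sub_apply, neg_apply, smul_apply, innerSL_apply_apply, smul_eq_mul,
      zero_apply] at this
    linarith
  rw [hval, abs_neg, abs_mul, abs_mul, abs_of_pos (inv_pos.2 hε), abs_of_pos (inv_pos.2 hn)]
  calc ε⁻¹ * (‖x - p‖⁻¹ * |inner ℝ (x - p) v|)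
      ≤ ε⁻¹ * (‖x - p‖⁻¹ * (η * ‖x - p‖ ^ 2)) := by gcongr
    _ = η * (ε⁻¹ * ‖x - p‖) := by field_simp
    _ ≤ η * (ε⁻¹ * ε) := by gcongr
    _ = η := by rw [inv_mul_cancel₀ hε.ne', mul_one]

/-- Integration by parts against a Lipschitz function. -/
theorem integral_mul_trace_fderiv {f : Ambient d → ℝ} {K : NNReal} (hf : LipschitzWith K f)
    {F : Ambient d → Ambient d} (hF : ContDiff ℝ 1 F) (hFc : HasCompactSupport F) :
    ∫ x, LinearMap.trace ℝ (Ambient d) (fderiv ℝ F x).toLinearMap * f x =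
      -∫ x, fderiv ℝ f x (F x) := by
  set e : Fin (d + 1) → Ambient d := fun k => EuclideanSpace.single k (1 : ℝ) with he
  have hFd : ∀ x, HasFDerivAt F (fderiv ℝ F x) x := fun x =>
    (hF.differentiable (by simp) x).hasFDerivAt
  have hcoord : ∀ k, ContDiff ℝ 1 fun x => F x k := fun k => by fun_prop
  have hcc : ∀ k, HasCompactSupport fun x => F x k := fun k =>
    hFc.comp_left (g := fun y : Ambient d => y k) rfl
  have hlin : ∀ k x, lineDeriv ℝ (fun x => F x k) x (-e k) = -(fderiv ℝ F x (e k)) k := by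
    intro k x
    have h1 : HasFDerivAt (fun x => F x k)
        ((EuclideanSpace.proj k : Ambient d →L[ℝ] ℝ) ∘L fderiv ℝ F x) x :=
      (EuclideanSpace.proj k : Ambient d →L[ℝ] ℝ).hasFDerivAt.comp x (hFd x)
    rw [(h1.hasLineDerivAt _).lineDeriv]
    simp
  have hparts : ∀ k, ∫ x, lineDeriv ℝ f x (e k) * F x k = ∫ x, -(fderiv ℝ F x (e k)) k * f x := by
    intro k
    obtain ⟨D, hD⟩ := (hcoord k).lipschitzWith_of_hasCompactSupport (hcc k) (by simp)
    rw [hf.integral_lineDeriv_mul_eq hD (hcc k)]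
    simp only [hlin]
  have hint1 : ∀ k, Integrable fun x => lineDeriv ℝ f x (e k) * F x k := fun k =>
    (hf.locallyIntegrable_lineDeriv (e k)).integrable_smul_right_of_hasCompactSupport
      (hcoord k).continuous (hcc k)
  have hint2 : ∀ k, Integrable fun x => -(fderiv ℝ F x (e k)) k * f x := by
    intro k
    refine Continuous.integrable_of_hasCompactSupport ?_ ?_
    · have h1 := hF.continuous_fderiv (by simp)
      have := hf.continuous
      fun_prop
    · refine HasCompactSupport.mul_right ?_
      exact (hFc.fderiv ℝ).comp_left (g := fun A : Ambient d →L[ℝ] Ambient d => -(A (e k)) k)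
        (by simp)
  have hL : ∫ x, LinearMap.trace ℝ (Ambient d) (fderiv ℝ F x).toLinearMap * f x =
      -∑ k, ∫ x, -(fderiv ℝ F x (e k)) k * f x := by
    rw [← integral_finsetSum _ fun k _ => hint2 k, ← integral_neg]
    refine integral_congr_ae (.of_forall fun x => ?_)
    simp only [trace_eq_sum_inner, EuclideanSpace.inner_single_left, map_one, one_mul, neg_mul,
      Finset.sum_neg_distrib, neg_neg, Finset.sum_mul, he]
  have hR : ∫ x, fderiv ℝ f x (F x) = ∑ k, ∫ x, lineDeriv ℝ f x (e k) * F x k := by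
    rw [← integral_finsetSum _ fun k _ => hint1 k]
    refine integral_congr_ae ?_
    filter_upwards [hf.ae_differentiableAt] with x hx
    have hsum : F x = ∑ k, F x k • e k := by
      have := (EuclideanSpace.basisFun (Fin (d + 1)) ℝ).sum_repr (F x)
      simpa [he] using this.symm
    conv_lhs => rw [hsum]
    rw [map_sum]
    refine Finset.sum_congr rfl fun k _ => ?_
    rw [map_smul, smul_eq_mul, (hx.hasFDerivAt.hasLineDerivAt _).lineDeriv, mul_comm]
  rw [hL, hR]
  simp only [hparts]

/-- The extension `F` of a tangential field is almost tangent to the level sets of the distance to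
`S`, with an error that is small compared with the distance. -/
theorem IsSmoothHypersurface.abs_inner_sub_nearest_le (hS : IsSmoothHypersurface S)
    {F : Ambient d → Ambient d} (hF : ContDiff ℝ 1 F)
    (hFc : HasCompactSupport F) (hFT : ∀ p ∈ S, F p ∈ tangentSpace S p)
    (hFn : ∀ p ∈ S, fderiv ℝ F p ∘L tangentProj S p = fderiv ℝ F p) (hη : 0 < η) :
    ∃ δ > 0, ∀ x, infDist x S < δ → ∀ p ∈ S, infDist x S = dist x p →
      |inner ℝ (x - p) (F x)| ≤ η * ‖x - p‖ ^ 2 := by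
  have huc : UniformContinuous (fderiv ℝ F) :=
    (hFc.fderiv ℝ).uniformContinuous_of_continuous (hF.continuous_fderiv (by simp))
  obtain ⟨δ, hδ, hδF⟩ := Metric.uniformContinuous_iff.1 huc η hη
  refine ⟨δ, hδ, fun x hx p hp hxp => ?_⟩
  have hmin : ∀ q ∈ S, dist x p ≤ dist x q := fun q hq => by
    rw [← hxp]; exact infDist_le_dist_of_mem hq
  have hproj := hS.tangentProj_sub_nearest hp hmin
  have h1 : inner ℝ (x - p) (F p) = 0 := by
    rw [← tangentProj_of_mem (hFT p hp), ← inner_tangentProj_left, hproj, inner_zero_left]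
  have h2 : fderiv ℝ F p (x - p) = 0 := by
    rw [← hFn p hp, ContinuousLinearMap.comp_apply, hproj, map_zero]
  have h3 : ‖F x - F p - fderiv ℝ F p (x - p)‖ ≤ η * ‖x - p‖ := by
    refine (convex_ball p δ).norm_image_sub_le_of_norm_hasFDerivWithin_le'
      (f' := fderiv ℝ F) (fun z _ =>
        (hF.differentiable (by simp) z).hasFDerivAt.hasFDerivWithinAt) (fun z hz => ?_)
      (mem_ball_self hδ) (by rw [mem_ball, ← hxp]; exact hx)
    rw [← dist_eq_norm]
    exact (hδF hz).le
  rw [h2, sub_zero] at h3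
  have h4 : inner ℝ (x - p) (F x) = inner ℝ (x - p) (F x - F p) := by
    rw [inner_sub_right, h1, sub_zero]
  rw [h4]
  calc |inner ℝ (x - p) (F x - F p)| ≤ ‖x - p‖ * ‖F x - F p‖ := abs_real_inner_le_norm _ _
    _ ≤ ‖x - p‖ * (η * ‖x - p‖) := by gcongr
    _ = η * ‖x - p‖ ^ 2 := by ring

/-- A form of the divergence theorem: the integral of `div F` against the collar of width `ε` is
of lower order than the volume `O(ε)` of the collar. -/
theorem IsSmoothHypersurface.integral_div_collar_le (hS : IsSmoothHypersurface S)
    (hSc : IsCompact S) (hne : S.Nonempty) {F : Ambient d → Ambient d} (hF : ContDiff ℝ 1 F)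
    (hFc : HasCompactSupport F) (hFT : ∀ p ∈ S, F p ∈ tangentSpace S p)
    (hFn : ∀ p ∈ S, fderiv ℝ F p ∘L tangentProj S p = fderiv ℝ F p) (hη : 0 < η) :
    ∀ᶠ ε in 𝓝[>] (0 : ℝ),
      ∫ x, LinearMap.trace ℝ (Ambient d) (fderiv ℝ F x).toLinearMap * collar S ε x ≤
        η * volume.real (thickening ε S) := by
  obtain ⟨δ, hδ, hδF⟩ := hS.abs_inner_sub_nearest_le hF hFc hFT hFn hη
  filter_upwards [self_mem_nhdsWithin, mem_nhdsWithin_of_mem_nhds (Iio_mem_nhds hδ)] with ε hε hεδ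
  rw [mem_Ioi] at hε
  rw [mem_Iio] at hεδ
  obtain ⟨K, hK⟩ := lipschitzWith_collar S ε
  rw [integral_mul_trace_fderiv hK hF hFc]
  refine (neg_le_abs _).trans ?_
  have hfin : volume (thickening ε S) ≠ ⊤ := hSc.isBounded.thickening.measure_lt_top.ne
  have hmeas : MeasurableSet (thickening ε S) := isOpen_thickening.measurableSet
  have hbound : ‖∫ x, fderiv ℝ (collar S ε) x (F x)‖ ≤
      ∫ x, (thickening ε S).indicator (fun _ => η) x := by
    refine norm_integral_le_of_norm_le
      ((integrable_indicator_iff hmeas).2 (integrableOn_const hfin)) ?_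
    filter_upwards [hK.ae_differentiableAt] with x hx
    obtain ⟨p, hp, hxp⟩ := hSc.exists_infDist_eq_dist hne x
    rw [Real.norm_eq_abs]
    by_cases hxε : infDist x S < ε
    · exact abs_fderiv_collar_le hε hp hxp hx (hδF x (hxε.trans hεδ) p hp hxp) hη.le
    · have hmin : IsLocalMin (collar S ε) x := .of_forall fun y => by
        rw [collar_eq_zero hε (not_lt.1 hxε)]; exact collar_nonneg _ _ _
      rw [hmin.fderiv_eq_zero]
      simpa using indicator_nonneg (fun _ _ => hη.le) x
  rw [Real.norm_eq_abs, integral_indicator_const _ hmeas, smul_eq_mul] at hbound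
  linarith

/-- If `div F` were positive at a point of `S`, its integral against the collar of width `ε` would
be at least of order `ε`, contradicting `IsSmoothHypersurface.integral_div_collar_le`. -/
theorem IsSmoothHypersurface.trace_fderiv_eq_zero (hS : IsSmoothHypersurface S)
    (hSc : IsCompact S) {F : Ambient d → Ambient d} (hF : ContDiff ℝ 1 F)
    (hFc : HasCompactSupport F) (hFT : ∀ p ∈ S, F p ∈ tangentSpace S p)
    (hFn : ∀ p ∈ S, fderiv ℝ F p ∘L tangentProj S p = fderiv ℝ F p)
    (hdiv : ∀ p ∈ S, 0 ≤ LinearMap.trace ℝ (Ambient d) (fderiv ℝ F p).toLinearMap) (hp : p ∈ S) :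
    LinearMap.trace ℝ (Ambient d) (fderiv ℝ F p).toLinearMap = 0 := by
  set g : Ambient d → ℝ := fun x => LinearMap.trace ℝ (Ambient d) (fderiv ℝ F x).toLinearMap
    with hg
  have hgsum : g = fun x => ∑ k : Fin (d + 1), inner ℝ (EuclideanSpace.single k (1 : ℝ))
      (fderiv ℝ F x (EuclideanSpace.single k (1 : ℝ))) :=
    funext fun x => trace_eq_sum_inner _
  have hgcont : Continuous g := by
    have h1 := hF.continuous_fderiv (by simp)
    rw [hgsum]
    fun_prop
  have hgcomp : HasCompactSupport g :=
    (hFc.fderiv ℝ).comp_left (g := fun A : Ambient d →L[ℝ] Ambient d =>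
      LinearMap.trace ℝ (Ambient d) A.toLinearMap) (by simp)
  have hguc := hgcomp.uniformContinuous_of_continuous hgcont
  refine le_antisymm ?_ (hdiv p hp)
  by_contra! hpos
  change 0 < g p at hpos
  set a := g p / 2 with ha
  have ha0 : 0 < a := by positivity
  obtain ⟨r, hr, hrg⟩ := Metric.eventually_nhds_iff_ball.1
    (hgcont.continuousAt.eventually_const_lt (show a < g p by linarith))
  obtain ⟨C, hC⟩ := hS.volume_thickening_le hSc
  obtain ⟨c, hc, hc'⟩ := hS.le_volume_thickening hp hr
  -- chosen so that the lower bound `a / 2 * c * ε / 2` beats `2 * η * C * ε`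
  set η := a * c / (16 * (|C| + 1)) with hη
  have hη0 : 0 < η := by positivity
  have hηC : 2 * η * C < a / 2 * (c / 2) := by
    have h1 : η * (16 * (|C| + 1)) = a * c := by rw [hη]; field_simp
    have h2 : η * C ≤ η * |C| := by gcongr; exact le_abs_self C
    have h3 : 0 < a * c := by positivity
    nlinarith
  obtain ⟨δ, hδ, hδg⟩ := Metric.uniformContinuous_iff.1 hguc η hη0
  have hhalf : ∀ᶠ ε in 𝓝[>] (0 : ℝ),
      c * (ε / 2) ≤ volume.real (thickening (ε / 2) S ∩ ball p r) := by
    have ht : Tendsto (fun ε : ℝ => ε / 2) (𝓝[>] 0) (𝓝[>] 0) := by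
      refine tendsto_nhdsWithin_iff.2 ⟨?_, ?_⟩
      · have : Continuous fun ε : ℝ => ε / 2 := by fun_prop
        have := this.tendsto 0
        rw [zero_div] at this
        exact this.mono_left nhdsWithin_le_nhds
      · filter_upwards [self_mem_nhdsWithin] with ε hε
        exact half_pos (mem_Ioi.1 hε)
    exact ht.eventually hc'
  have hlt : ∀ᶠ ε in 𝓝[>] (0 : ℝ), ε < δ := mem_nhdsWithin_of_mem_nhds (Iio_mem_nhds hδ)
  have hgt : ∀ᶠ ε in 𝓝[>] (0 : ℝ), 0 < ε := self_mem_nhdsWithin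
  obtain ⟨ε, hε, hεδ, hεC, hεc, hεint⟩ := (hgt.and (hlt.and (hC.and (hhalf.and
    (hS.integral_div_collar_le hSc ⟨p, hp⟩ hF hFc hFT hFn hη0))))).exists
  set N := thickening ε S with hN
  set B := thickening (ε / 2) S ∩ ball p r with hB
  have hNm : MeasurableSet N := isOpen_thickening.measurableSet
  have hBm : MeasurableSet B := isOpen_thickening.measurableSet.inter measurableSet_ball
  have hNfin : volume N ≠ ⊤ := hSc.isBounded.thickening.measure_lt_top.ne
  have hBfin : volume B ≠ ⊤ :=
    ((measure_mono inter_subset_right).trans_lt measure_ball_lt_top).ne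
  have hBint : Integrable (B.indicator fun _ => a / 2) :=
    (integrable_indicator_iff hBm).2 (integrableOn_const hBfin)
  have hNint : Integrable (N.indicator fun _ => η) :=
    (integrable_indicator_iff hNm).2 (integrableOn_const hNfin)
  have hne : S.Nonempty := ⟨p, hp⟩
  have hlower : ∫ x, (B.indicator (fun _ => a / 2) x - N.indicator (fun _ => η) x) ≤
      ∫ x, g x * collar S ε x := by
    obtain ⟨K, hK⟩ := lipschitzWith_collar S ε
    refine integral_mono (hBint.sub hNint) ?_ fun x => ?_
    · exact (hgcont.mul hK.continuous).integrable_of_hasCompactSupport hgcomp.mul_right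
    · have h0 := collar_nonneg S ε x
      have h1 := collar_le_one (S := S) hε x
      by_cases hxN : x ∈ N
      · rw [indicator_of_mem hxN]
        by_cases hxB : x ∈ B
        · rw [indicator_of_mem hxB]
          have h2 : a < g x := hrg x hxB.2
          have h3 := half_le_collar hε
            ((infDist_lt_iff hne).2 (mem_thickening_iff.1 hxB.1)).le
          nlinarith
        · rw [indicator_of_notMem hxB]
          obtain ⟨z, hz, hxz⟩ := mem_thickening_iff.1 hxN
          have h2 := hδg (hxz.trans hεδ)
          rw [Real.dist_eq] at h2
          have h3 := (abs_lt.1 h2).1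
          have h4 : 0 ≤ g z := hdiv z hz
          nlinarith
      · have hxB : x ∉ B := fun hxB => hxN (thickening_mono (by linarith) _ hxB.1)
        have hge : ε ≤ infDist x S := by
          by_contra! hlt
          exact hxN (mem_thickening_iff.2 ((infDist_lt_iff hne).1 hlt))
        rw [indicator_of_notMem hxN, indicator_of_notMem hxB, collar_eq_zero hε hge]
        simp
  rw [integral_sub hBint hNint, integral_indicator_const _ hBm, integral_indicator_const _ hNm,
    smul_eq_mul, smul_eq_mul] at hlower
  have h5 : volume.real B * (a / 2) - volume.real N * η ≤ η * volume.real N :=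
    hlower.trans hεint
  have h6 : a / 2 * (c * (ε / 2)) ≤ a / 2 * volume.real B := by gcongr
  have h7 : η * volume.real N ≤ η * (C * ε) := by gcongr
  have h8 : 2 * η * C * ε < a / 2 * (c / 2) * ε := by gcongr
  linarith

/-- On a compact hypersurface, a tangential `C¹` field whose divergence has a sign is divergence
free. -/
theorem IsTangentialField.surfaceDiv_eq_zero {w : Ambient d → Ambient d}
    (hw : IsTangentialField 1 S w) (hS : IsSmoothHypersurface S) (hSc : IsCompact S)
    (hdiv : ∀ p ∈ S, 0 ≤ surfaceDiv S w p) (hp : p ∈ S) : surfaceDiv S w p = 0 := by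
  obtain ⟨G, hG⟩ := hw.1.exists_normalExtension hS hSc.isClosed le_rfl
  obtain ⟨R, hR⟩ := hSc.isBounded.subset_ball_lt 0 0
  let χ : ContDiffBump (0 : Ambient d) := ⟨R, R + 1, hR.1, by linarith⟩
  have hone : ∀ q ∈ S, (fun x => χ x • G x) =ᶠ[𝓝 q] G := fun q hq => by
    have : (χ : Ambient d → ℝ) =ᶠ[𝓝 q] 1 := χ.eventuallyEq_one_of_mem_ball (hR.2 hq)
    filter_upwards [this] with x hx
    simp [hx]
  have hder : ∀ q ∈ S, fderiv ℝ (fun x => χ x • G x) q = surfaceDeriv S w q := fun q hq =>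
    ((hG.hasFDerivAt q hq).congr_of_eventuallyEq (hone q hq)).fderiv
  have hdiv' : ∀ q ∈ S, LinearMap.trace ℝ (Ambient d)
      (fderiv ℝ (fun x => χ x • G x) q).toLinearMap = surfaceDiv S w q := fun q hq => by
    rw [hder q hq, surfaceDiv]
  rw [← hdiv' p hp]
  refine hS.trace_fderiv_eq_zero hSc (χ.contDiff.smul hG.contDiff)
    χ.hasCompactSupport.smul_right (fun q hq => ?_) (fun q hq => ?_)
    (fun q hq => (hdiv' q hq).symm ▸ hdiv q hq) hp
  · rw [(hone q hq).eq_of_nhds, hG.eqOn hq]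
    exact hw.2 q hq
  · rw [hder q hq]
    ext1 v
    exact surfaceDeriv_tangentProj S w q v

end

/-! ### Functions with vanishing differential -/

section

variable {d : ℕ}

open Metric Set Filter

variable {S U : Set (Ambient d)} {ρ : Ambient d → ℝ} {p q x ν : Ambient d} {R c L : ℝ}
  {f : Ambient d → ℝ}

/-- Projecting a segment along `ν` gives a Lipschitz curve in `S` between nearby points. -/
theorem IsGraphNear.exists_lipschitz_curve (h : IsGraphNear S ρ p ν R c L) (hp : p ∈ S)
    (hx : x ∈ S) (hxR : ‖x - p‖ + L * ‖x - p‖ / c < R) :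
    ∃ γ : ℝ → Ambient d, γ 0 = p ∧ γ 1 = x ∧ (∀ s ∈ Icc (0 : ℝ) 1, γ s ∈ S) ∧
      ∃ K : ℝ, ∀ s ∈ Icc (0 : ℝ) 1, ∀ s' ∈ Icc (0 : ℝ) 1, ‖γ s - γ s'‖ ≤ K * |s - s'| := by
  have hR := h.radius_pos
  have hc := h.rate_pos
  have hL := h.lip_pos
  have hρp : ρ p = 0 := (h.mem_iff p (mem_ball_self hR)).1 hp
  set z : ℝ → Ambient d := fun s => p + s • (x - p) with hz
  have hzp : ∀ s ∈ Icc (0 : ℝ) 1, ‖z s - p‖ ≤ ‖x - p‖ := fun s hs => by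
    rw [hz]
    simp only [add_sub_cancel_left, norm_smul, Real.norm_of_nonneg hs.1]
    exact mul_le_of_le_one_left (norm_nonneg _) hs.2
  have hball : ∀ s ∈ Icc (0 : ℝ) 1, ∀ t : ℝ, c * |t| ≤ L * ‖x - p‖ → z s + t • ν ∈ ball p R := by
    intro s hs t ht
    have ht' : |t| ≤ L * ‖x - p‖ / c := by rw [le_div_iff₀ hc]; linarith
    rw [mem_ball_iff_norm]
    calc ‖z s + t • ν - p‖ = ‖(z s - p) + t • ν‖ := by congr 1; abel
      _ ≤ ‖z s - p‖ + ‖t • ν‖ := norm_add_le _ _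
      _ = ‖z s - p‖ + |t| := by rw [norm_smul, h.norm_eq, mul_one, Real.norm_eq_abs]
      _ ≤ ‖x - p‖ + L * ‖x - p‖ / c := add_le_add (hzp s hs) ht'
      _ < R := hxR
  have hzR : ∀ s ∈ Icc (0 : ℝ) 1, z s ∈ ball p R := fun s hs => by
    simpa using hball s hs 0 (by simp; positivity)
  have hρz : ∀ s ∈ Icc (0 : ℝ) 1, |ρ (z s)| ≤ L * ‖x - p‖ := by
    intro s hs
    have := h.lip _ (hzR s hs) p (mem_ball_self hR)
    rw [hρp, sub_zero] at this
    exact this.trans (by gcongr; exact hzp s hs)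
  have hex : ∀ s ∈ Icc (0 : ℝ) 1, ∃ t : ℝ, c * |t| ≤ |ρ (z s)| ∧ z s + t • ν ∈ ball p R ∧
      z s + t • ν ∈ S := fun s hs => h.exists_add_smul_mem (by
    calc ‖z s - p‖ + |ρ (z s)| / c ≤ ‖x - p‖ + L * ‖x - p‖ / c := by
          gcongr
          · exact hzp s hs
          · exact hρz s hs
      _ < R := hxR)
  choose! t ht1 ht2 ht3 using hex
  have hend : ∀ s ∈ Icc (0 : ℝ) 1, z s ∈ S → t s = 0 := fun s hs hzs => by
    have := ht1 s hs
    rw [(h.mem_iff _ (hzR s hs)).1 hzs, abs_zero] at this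
    have h2 : |t s| ≤ 0 := nonpos_of_mul_nonpos_right this hc
    simpa using h2
  have hz0 : z 0 = p := by simp [hz]
  have hz1 : z 1 = x := by simp [hz]
  refine ⟨fun s => z s + t s • ν, ?_, ?_, ht3, ‖x - p‖ + L * ‖x - p‖ / c, ?_⟩
  · simp [hend 0 (by simp) (by rwa [hz0]), hz0]
  · simp [hend 1 (by simp) (by rwa [hz1]), hz1]
  · intro s hs s' hs'
    have hzz : ‖z s - z s'‖ = ‖x - p‖ * |s - s'| := by
      rw [hz]
      simp only [add_sub_add_left_eq_sub, ← sub_smul, norm_smul, Real.norm_eq_abs, mul_comm]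
    have hb' : z s' + t s • ν ∈ ball p R := hball s' hs' _ ((ht1 s hs).trans (hρz s hs))
    have h1 := h.rate_mul_abs_le hb' (ht2 s' hs')
    have h2 := h.lip _ hb' _ (ht2 s hs)
    rw [(h.mem_iff _ (ht2 s' hs')).1 (ht3 s' hs'), sub_zero] at h1
    rw [(h.mem_iff _ (ht2 s hs)).1 (ht3 s hs), sub_zero, add_sub_add_right_eq_sub,
      norm_sub_rev, hzz] at h2
    have h3 : |t s - t s'| ≤ L * (‖x - p‖ * |s - s'|) / c := by
      rw [le_div_iff₀ hc]; linarith
    calc ‖z s + t s • ν - (z s' + t s' • ν)‖ = ‖(z s - z s') + (t s - t s') • ν‖ := by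
          congr 1; rw [sub_smul]; abel
      _ ≤ ‖z s - z s'‖ + ‖(t s - t s') • ν‖ := norm_add_le _ _
      _ = ‖x - p‖ * |s - s'| + |t s - t s'| := by
          rw [norm_smul, h.norm_eq, mul_one, Real.norm_eq_abs, hzz]
      _ ≤ ‖x - p‖ * |s - s'| + L * (‖x - p‖ * |s - s'|) / c := by gcongr
      _ = (‖x - p‖ + L * ‖x - p‖ / c) * |s - s'| := by ring

theorem eq_of_hasFDerivWithinAt_zero_of_curve (hf : ∀ p ∈ S, HasFDerivWithinAt f (0 : Ambient d →L[ℝ] ℝ) S p)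
    {γ : ℝ → Ambient d} (hγS : ∀ s ∈ Icc (0 : ℝ) 1, γ s ∈ S) {K : ℝ}
    (hγ : ∀ s ∈ Icc (0 : ℝ) 1, ∀ s' ∈ Icc (0 : ℝ) 1, ‖γ s - γ s'‖ ≤ K * |s - s'|) :
    f (γ 1) = f (γ 0) := by
  have hder : ∀ s ∈ Icc (0 : ℝ) 1, HasDerivWithinAt (f ∘ γ) 0 (Icc 0 1) s := by
    intro s hs
    have hO : (fun s' => γ s' - γ s) =O[𝓝[Icc 0 1] s] fun s' => s' - s := by
      refine Asymptotics.IsBigO.of_bound K ?_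
      filter_upwards [self_mem_nhdsWithin] with s' hs'
      exact hγ s' hs' s hs
    have hlim : Tendsto γ (𝓝[Icc 0 1] s) (𝓝[S] (γ s)) := by
      refine tendsto_nhdsWithin_iff.2 ⟨?_, ?_⟩
      · have h0 : Tendsto (fun s' : ℝ => s' - s) (𝓝[Icc 0 1] s) (𝓝 0) := by
          have : Continuous fun s' : ℝ => s' - s := by fun_prop
          have := this.tendsto s
          rw [sub_self] at this
          exact this.mono_left nhdsWithin_le_nhds
        exact tendsto_sub_nhds_zero_iff.1 (hO.trans_tendsto h0)
      · filter_upwards [self_mem_nhdsWithin] with s' hs' using hγS s' hs'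
    have h1 := ((hasFDerivWithinAt_iff_isLittleO.1 (hf _ (hγS s hs))).comp_tendsto hlim).trans_isBigO
      hO
    rw [hasDerivWithinAt_iff_isLittleO]
    simpa [Function.comp_def] using h1
  have := (convex_Icc (0 : ℝ) 1).norm_image_sub_le_of_norm_hasDerivWithin_le (C := 0) hder
    (fun s _ => by simp) (left_mem_Icc.2 zero_le_one) (right_mem_Icc.2 zero_le_one)
  simpa [sub_eq_zero] using this

/-- A function on a connected hypersurface is constant if its differential vanishes. -/
theorem IsSmoothHypersurface.exists_eq_const (hS : IsSmoothHypersurface S) (hconn : IsConnected S)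
    (hf : ∀ p ∈ S, HasFDerivWithinAt f (0 : Ambient d →L[ℝ] ℝ) S p) : ∃ C, ∀ p ∈ S, f p = C := by
  have hloc : IsLocallyConstant fun p : S => f p := by
    rw [IsLocallyConstant.iff_eventually_eq]
    rintro ⟨p, hp⟩
    obtain ⟨U, ρ, hpU, h⟩ := hS.exists_definingFunction hp
    obtain ⟨ν, R, c, L, -, hG⟩ := h.exists_isGraphNear hpU
    have hev : ∀ᶠ x in 𝓝 p, ‖x - p‖ + L * ‖x - p‖ / c < R := by
      have h1 : Continuous fun x => ‖x - p‖ + L * ‖x - p‖ / c := by fun_prop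
      have h2 := h1.tendsto p
      simp only [sub_self, norm_zero, mul_zero, zero_div, add_zero] at h2
      exact h2.eventually_lt_const hG.radius_pos
    filter_upwards [continuous_subtype_val.continuousAt.eventually hev] with x hx
    obtain ⟨γ, h0, h1, hγS, K, hγ⟩ := hG.exists_lipschitz_curve hp x.2 hx
    have := eq_of_hasFDerivWithinAt_zero_of_curve hf hγS hγ
    rwa [h0, h1] at this
  obtain ⟨p₀, hp₀⟩ := hconn.nonempty
  have : PreconnectedSpace S := Subtype.preconnectedSpace hconn.isPreconnected
  exact ⟨f p₀, fun p hp => hloc.apply_eq_of_preconnectedSpace ⟨p, hp⟩ ⟨p₀, hp₀⟩⟩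

end

/-! ### Strain, Killing fields and equilibria -/

section

variable {d : ℕ}

open Set ContinuousLinearMap

variable {S : Set (Ambient d)} {p v w : Ambient d} {u : Ambient d → Ambient d}
  {π : Ambient d → ℝ} {μ : ℝ}

theorem trace_comp_comm (A B : Ambient d →L[ℝ] Ambient d) :
    LinearMap.trace ℝ (Ambient d) (A ∘L B).toLinearMap =
      LinearMap.trace ℝ (Ambient d) (B ∘L A).toLinearMap :=
  LinearMap.trace_mul_comm ℝ A.toLinearMap B.toLinearMap

theorem sum_apply_single_mul (φ : Ambient d →L[ℝ] ℝ) (v : Ambient d) :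
    ∑ k : Fin (d + 1), φ (EuclideanSpace.single k 1) *
      inner ℝ (EuclideanSpace.single k (1 : ℝ)) v = φ v := by
  conv_rhs => rw [← (EuclideanSpace.basisFun (Fin (d + 1)) ℝ).sum_repr v]
  simp [map_sum, EuclideanSpace.inner_single_left, mul_comm]

theorem inner_strain (S : Set (Ambient d)) (u : Ambient d → Ambient d) (p v w : Ambient d) :
    inner ℝ (strain S u p v) w =
      1 / 2 * (inner ℝ (surfaceDeriv S u p v) (tangentProj S p w) +
        inner ℝ (tangentProj S p v) (surfaceDeriv S u p w)) := by
  have h : strain S u p v = (1 / 2 : ℝ) • tangentProj S p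
      (adjoint (surfaceDeriv S u p) (tangentProj S p v) + surfaceDeriv S u p v) := by
    simp [strain, surfaceGrad, surfaceDeriv_tangentProj]
  rw [h, real_inner_smul_left, inner_tangentProj_left, inner_add_left, adjoint_inner_left,
    surfaceDeriv_tangentProj, add_comm]

theorem inner_strain_comm (S : Set (Ambient d)) (u : Ambient d → Ambient d) (p v w : Ambient d) :
    inner ℝ (strain S u p v) w = inner ℝ v (strain S u p w) := by
  rw [real_inner_comm (strain S u p w) v, inner_strain, inner_strain, real_inner_comm (tangentProj S p w),
    real_inner_comm (surfaceDeriv S u p w), add_comm]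

theorem tangentProj_strain (S : Set (Ambient d)) (u : Ambient d → Ambient d) (p v : Ambient d) :
    tangentProj S p (strain S u p v) = strain S u p v := by
  simp [strain, tangentProj_tangentProj]

theorem strain_tangentProj (S : Set (Ambient d)) (u : Ambient d → Ambient d) (p v : Ambient d) :
    strain S u p (tangentProj S p v) = strain S u p v := by
  simp [strain, tangentProj_tangentProj]

theorem trace_strain (S : Set (Ambient d)) (u : Ambient d → Ambient d) (p : Ambient d) :
    LinearMap.trace ℝ (Ambient d) (strain S u p).toLinearMap = surfaceDiv S u p := by
  have h1 : surfaceDeriv S u p ∘L tangentProj S p = surfaceDeriv S u p := by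
    ext1 v; exact surfaceDeriv_tangentProj S u p v
  have h2 := trace_comp_comm (tangentProj S p) (surfaceDeriv S u p)
  rw [h1, trace_eq_sum_inner] at h2
  rw [surfaceDiv, ← h2, trace_eq_sum_inner]
  refine Finset.sum_congr rfl fun k _ => ?_
  rw [real_inner_comm, inner_strain, real_inner_comm (surfaceDeriv S u p _) (tangentProj S p _),
    ContinuousLinearMap.comp_apply, ← inner_tangentProj_left, real_inner_comm]
  ring

/-- The strain is the symmetric part of the differential, so `tr (D ∇u) = |D|²`. -/
theorem trace_strain_comp_surfaceDeriv (S : Set (Ambient d)) (u : Ambient d → Ambient d)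
    (p : Ambient d) :
    LinearMap.trace ℝ (Ambient d) (strain S u p ∘L surfaceDeriv S u p).toLinearMap =
      ∑ k : Fin (d + 1), ‖strain S u p (EuclideanSpace.single k (1 : ℝ))‖ ^ 2 := by
  set K := strain S u p with hK
  set A := surfaceDeriv S u p with hA
  have hKP : K ∘L tangentProj S p = K := by ext1 v; exact strain_tangentProj S u p v
  have h1 : LinearMap.trace ℝ (Ambient d) (tangentProj S p ∘L (A ∘L K)).toLinearMap =
      LinearMap.trace ℝ (Ambient d) (K ∘L A).toLinearMap := by
    rw [← ContinuousLinearMap.comp_assoc, trace_comp_comm, ← ContinuousLinearMap.comp_assoc, hKP]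
  have h2 : ∀ v : Ambient d, ‖K v‖ ^ 2 =
      1 / 2 * (inner ℝ v ((K ∘L A) v) + inner ℝ v ((tangentProj S p ∘L (A ∘L K)) v)) := by
    intro v
    rw [← real_inner_self_eq_norm_sq]
    conv_lhs => rw [hK]
    rw [inner_strain, tangentProj_strain, real_inner_comm, inner_strain_comm,
      inner_tangentProj_left]
    rfl
  simp only [h2, ← Finset.mul_sum, Finset.sum_add_distrib]
  rw [← trace_eq_sum_inner, ← trace_eq_sum_inner, h1]
  ring

theorem isKillingField_iff (hS : IsSmoothHypersurface S) :
    IsKillingField S u ↔ ∀ p ∈ S, strain S u p = 0 := by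
  have key : ∀ p v w, v ∈ tangentSpace S p → w ∈ tangentSpace S p →
      inner ℝ (tangentProj S p (surfaceDeriv S u p v)) w +
        inner ℝ (tangentProj S p (surfaceDeriv S u p w)) v = 2 * inner ℝ (strain S u p v) w := by
    intro p v w hv hw
    rw [inner_strain, inner_tangentProj_left, inner_tangentProj_left, tangentProj_of_mem hv,
      tangentProj_of_mem hw, real_inner_comm v]
    ring
  constructor
  · intro h p hp
    have hfield : ∀ v, IsTangentialField 1 S fun x => tangentProj S x v := fun v =>
      ⟨fun q hq => by
        obtain ⟨g, hg, hgP⟩ := hS.isContDiffOnSurface_tangentProj 1 q hq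
        exact ⟨fun x => g x v, hg.clm_apply contDiffAt_const, hgP.mono fun x hx => by simp only [hx]⟩,
        fun q _ => tangentProj_mem S q v⟩
    ext1 v
    have h1 := h _ _ (hfield v) (hfield (strain S u p v)) p hp
    rw [covDeriv, covDeriv, convect, convect, key p _ _ (tangentProj_mem S p v)
      (tangentProj_mem S p _), strain_tangentProj, tangentProj_strain] at h1
    simpa using h1
  · intro h v w hv hw p hp
    rw [covDeriv, covDeriv, convect, convect, key p _ _ (hv.2 p hp) (hw.2 p hp), h p hp]
    simp

theorem IsTangentialField.isContDiffOnSurface_strain (hu : IsTangentialField 2 S u)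
    (hS : IsSmoothHypersurface S) (hSc : IsClosed S) : IsContDiffOnSurface 1 S (strain S u) := by
  obtain ⟨F, hF⟩ := hu.1.exists_normalExtension hS hSc one_le_two
  obtain ⟨Q, hQ⟩ := (hS.isContDiffOnSurface_tangentProj 1).exists_normalExtension hS hSc le_rfl
  have hF' : ContDiff ℝ 1 (fderiv ℝ F) := hF.contDiff.fderiv_right (by norm_num)
  have hadj : ContDiff ℝ 1 fun x => adjoint (fderiv ℝ F x) :=
    (adjoint : (Ambient d →L[ℝ] Ambient d) ≃ₗᵢ⋆[ℝ] _).contDiff.comp hF'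
  refine ContDiff.isContDiffOnSurface (G := fun x => (1 / 2 : ℝ) • (Q x ∘L
    (adjoint (fderiv ℝ F x) + fderiv ℝ F x) ∘L Q x)) ?_ fun x hx => ?_
  · exact (hQ.contDiff.clm_comp ((hadj.add hF').clm_comp hQ.contDiff)).const_smul _
  · simp only [strain, surfaceGrad, adjoint_adjoint, hQ.eqOn hx, (hF.hasFDerivAt x hx).fderiv]

theorem inner_surfaceDivTensor (S : Set (Ambient d))
    (K : Ambient d → (Ambient d →L[ℝ] Ambient d)) (p w : Ambient d) :
    inner ℝ (surfaceDivTensor S K p) w = ∑ k : Fin (d + 1),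
      inner ℝ (EuclideanSpace.single k (1 : ℝ))
        (surfaceDeriv S K p (EuclideanSpace.single k (1 : ℝ)) w) := by
  simp only [surfaceDivTensor, sum_inner, adjoint_inner_left]

/-- The divergence of the projection `P` is normal: as `P² = P`, the differential of `P` maps
tangent vectors to normal vectors. -/
theorem IsSmoothHypersurface.inner_surfaceDivTensor_tangentProj (hS : IsSmoothHypersurface S)
    (hSc : IsClosed S) (hp : p ∈ S) (hw : w ∈ tangentSpace S p) :
    inner ℝ (surfaceDivTensor S (tangentProj S) p) w = 0 := by
  obtain ⟨Q, hQ⟩ := (hS.isContDiffOnSurface_tangentProj 1).exists_normalExtension hS hSc le_rfl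
  set D := surfaceDeriv S (tangentProj S) p with hD
  have hd := (hQ.hasFDerivAt p hp).clm_comp (hQ.hasFDerivAt p hp)
  have h1 := surfaceDeriv_eq (f := tangentProj S) hd hp (by
    filter_upwards [self_mem_nhdsWithin] with x hx
    rw [hQ.eqOn hx]
    ext1 v
    exact tangentProj_tangentProj S x v)
  have h2 : ∀ v, tangentProj S p (D v w) = 0 := by
    intro v
    have h3 := DFunLike.congr_fun (DFunLike.congr_fun h1 v) w
    simp only [ContinuousLinearMap.comp_apply, add_apply, hQ.eqOn hp, compL_apply, flip_apply,
      surfaceDeriv_tangentProj, tangentProj_of_mem hw] at h3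
    simpa using h3
  have h3 := trace_comp_comm (D.flip w) (tangentProj S p)
  have h4 : D.flip w ∘L tangentProj S p = D.flip w := by
    ext1 v
    simp [hD, surfaceDeriv_tangentProj]
  have h5 : tangentProj S p ∘L D.flip w = 0 := by
    ext1 v
    simp [h2]
  rw [h4, h5, trace_eq_sum_inner] at h3
  rw [inner_surfaceDivTensor]
  simpa using h3

/-- The momentum equation of an equilibrium, tested with a tangent vector. -/
theorem IsTangentialField.inner_momentum (hu : IsTangentialField 2 S u)
    (hπ : IsContDiffOnSurface 1 S π) (hS : IsSmoothHypersurface S) (hSc : IsClosed S)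
    (hp : p ∈ S) (hw : w ∈ tangentSpace S p) :
    inner ℝ (tangentProj S p (convect S u u p) -
        tangentProj S p (surfaceDivTensor S (stress μ S u π) p)) w =
      inner ℝ (surfaceDeriv S u p (u p)) w -
        2 * μ * inner ℝ (surfaceDivTensor S (strain S u) p) w + surfaceDeriv S π p w := by
  obtain ⟨Q, hQ⟩ := (hS.isContDiffOnSurface_tangentProj 1).exists_normalExtension hS hSc le_rfl
  obtain ⟨H, hH⟩ := hπ.exists_normalExtension hS hSc le_rfl
  obtain ⟨K, hK⟩ :=
    (hu.isContDiffOnSurface_strain hS hSc).exists_normalExtension hS hSc le_rfl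
  have hd := ((hK.hasFDerivAt p hp).const_smul (2 * μ)).sub
    ((hH.hasFDerivAt p hp).smul (hQ.hasFDerivAt p hp))
  have h1 := surfaceDeriv_eq (f := stress μ S u π) hd hp (by
    filter_upwards [self_mem_nhdsWithin] with x hx
    simp [stress, hK.eqOn hx, hH.eqOn hx, hQ.eqOn hx])
  have h2 : ∀ v, surfaceDeriv S (stress μ S u π) p v w =
      (2 * μ) • surfaceDeriv S (strain S u) p v w - (surfaceDeriv S π p v • w +
        π p • surfaceDeriv S (tangentProj S) p v w) := by
    intro v
    rw [h1]
    simp [surfaceDeriv_tangentProj, hH.eqOn hp, hQ.eqOn hp, tangentProj_of_mem hw]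
    abel
  have h3 := hS.inner_surfaceDivTensor_tangentProj hSc hp hw
  rw [inner_surfaceDivTensor] at h3
  rw [inner_sub_left, inner_tangentProj_left, inner_tangentProj_left, tangentProj_of_mem hw,
    inner_surfaceDivTensor, inner_surfaceDivTensor]
  simp only [h2, inner_sub_right, inner_add_right, real_inner_smul_right, Finset.sum_sub_distrib,
    Finset.sum_add_distrib, ← Finset.mul_sum, h3, sum_apply_single_mul, convect]
  ring

/-- The field `2 μ D(u) u - (|u|² / 2 + π) u`, whose divergence is `2 μ |D(u)|²` at an
equilibrium. -/
def energyFlux (μ : ℝ) (S : Set (Ambient d)) (u : Ambient d → Ambient d) (π : Ambient d → ℝ)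
    (p : Ambient d) : Ambient d :=
  (2 * μ) • strain S u p (u p) - (1 / 2 * ‖u p‖ ^ 2 + π p) • u p

/-- The chain rule for the kinetic energy density plus a pressure. -/
theorem hasFDerivAt_half_norm_sq_add {F : Ambient d → Ambient d} {H : Ambient d → ℝ}
    {F' : Ambient d →L[ℝ] Ambient d} {H' : Ambient d →L[ℝ] ℝ} (hF : HasFDerivAt F F' p)
    (hH : HasFDerivAt H H' p) :
    HasFDerivAt (fun x => 1 / 2 * ‖F x‖ ^ 2 + H x) ((innerSL ℝ (F p)).comp F' + H') p := by
  refine ((hF.norm_sq.const_mul (1 / 2)).add hH).congr_fderiv ?_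
  ext v
  simp

theorem IsTangentialField.isTangentialField_energyFlux (hu : IsTangentialField 2 S u)
    (hπ : IsContDiffOnSurface 1 S π) (hS : IsSmoothHypersurface S) (hSc : IsClosed S) :
    IsTangentialField 1 S (energyFlux μ S u π) := by
  obtain ⟨F, hF⟩ := (hu.1.of_le one_le_two).exists_normalExtension hS hSc le_rfl
  obtain ⟨H, hH⟩ := hπ.exists_normalExtension hS hSc le_rfl
  obtain ⟨K, hK⟩ :=
    (hu.isContDiffOnSurface_strain hS hSc).exists_normalExtension hS hSc le_rfl
  refine ⟨ContDiff.isContDiffOnSurface (G := fun x => (2 * μ) • K x (F x) -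
    (1 / 2 * ‖F x‖ ^ 2 + H x) • F x) ?_ fun x hx => ?_, fun q hq => ?_⟩
  · have h1 := hF.contDiff
    have h2 := hH.contDiff
    have h3 := hK.contDiff
    exact ((h3.clm_apply h1).const_smul _).sub
      (((contDiff_const.mul (h1.norm_sq ℝ)).add h2).smul h1)
  · simp [energyFlux, hF.eqOn hx, hH.eqOn hx, hK.eqOn hx]
  · refine Submodule.sub_mem _ (Submodule.smul_mem _ _ ?_) (Submodule.smul_mem _ _ (hu.2 q hq))
    rw [← tangentProj_strain]
    exact tangentProj_mem S q _

theorem IsTangentialField.surfaceDiv_energyFlux (hu : IsTangentialField 2 S u)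
    (hπ : IsContDiffOnSurface 1 S π) (hS : IsSmoothHypersurface S) (hSc : IsClosed S)
    (hp : p ∈ S) :
    surfaceDiv S (energyFlux μ S u π) p =
      2 * μ * ∑ k : Fin (d + 1), ‖strain S u p (EuclideanSpace.single k (1 : ℝ))‖ ^ 2
      - inner ℝ (tangentProj S p (convect S u u p) -
        tangentProj S p (surfaceDivTensor S (stress μ S u π) p)) (u p)
      - (1 / 2 * ‖u p‖ ^ 2 + π p) * surfaceDiv S u p := by
  rw [hu.inner_momentum hπ hS hSc hp (hu.2 p hp), ← trace_strain_comp_surfaceDeriv,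
    inner_surfaceDivTensor]
  obtain ⟨F, hF⟩ := (hu.1.of_le one_le_two).exists_normalExtension hS hSc le_rfl
  obtain ⟨H, hH⟩ := hπ.exists_normalExtension hS hSc le_rfl
  obtain ⟨K, hK⟩ :=
    (hu.isContDiffOnSurface_strain hS hSc).exists_normalExtension hS hSc le_rfl
  have hFd := hF.hasFDerivAt p hp
  have hd := (((hK.hasFDerivAt p hp).clm_apply hFd).const_smul (2 * μ)).sub
    ((hasFDerivAt_half_norm_sq_add hFd (hH.hasFDerivAt p hp)).smul hFd)
  have h1 := surfaceDeriv_eq (f := energyFlux μ S u π) hd hp (by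
    filter_upwards [self_mem_nhdsWithin] with x hx
    simp [energyFlux, hK.eqOn hx, hH.eqOn hx, hF.eqOn hx])
  have h2 : ∀ v, surfaceDeriv S (energyFlux μ S u π) p v =
      (2 * μ) • (surfaceDeriv S (strain S u) p v (u p) +
        (strain S u p ∘L surfaceDeriv S u p) v) -
      (((innerSL ℝ (u p)).comp (surfaceDeriv S u p) + surfaceDeriv S π p) v • u p +
        (1 / 2 * ‖u p‖ ^ 2 + π p) • surfaceDeriv S u p v) := by
    intro v
    rw [h1]
    simp [surfaceDeriv_tangentProj, hH.eqOn hp, hK.eqOn hp, hF.eqOn hp]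
    abel
  rw [surfaceDiv, surfaceDiv, trace_eq_sum_inner, trace_eq_sum_inner, trace_eq_sum_inner]
  simp only [h2, inner_sub_right, inner_add_right, real_inner_smul_right, Finset.sum_sub_distrib,
    Finset.sum_add_distrib, ← Finset.mul_sum]
  rw [sum_apply_single_mul, real_inner_comm (u p) (surfaceDeriv S u p (u p))]
  simp only [add_apply, ContinuousLinearMap.comp_apply, innerSL_apply_apply]
  ring

theorem isEquilibrium_iff : IsEquilibrium μ S u π ↔ ∀ p ∈ S,
    tangentProj S p (convect S u u p) -
        tangentProj S p (surfaceDivTensor S (stress μ S u π) p) = 0 ∧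
      surfaceDiv S u p = 0 := by
  simp only [IsEquilibrium, IsSurfaceNavierStokesSolution, deriv_const, zero_add]
  exact ⟨fun h => h 1 one_pos, fun h _ _ => h⟩

/-- The energy method: the strain of an equilibrium vanishes, because `2 μ |D(u)|²` is the
divergence of the energy flux. -/
theorem IsTangentialField.strain_eq_zero (hu : IsTangentialField 2 S u)
    (hπ : IsContDiffOnSurface 1 S π) (hS : IsSmoothHypersurface S) (hSc : IsCompact S)
    (hμ : 0 < μ) (heq : IsEquilibrium μ S u π) (hp : p ∈ S) : strain S u p = 0 := by
  have hdiv : ∀ q ∈ S, surfaceDiv S (energyFlux μ S u π) q =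
      2 * μ * ∑ k : Fin (d + 1), ‖strain S u q (EuclideanSpace.single k (1 : ℝ))‖ ^ 2 := by
    intro q hq
    obtain ⟨h1, h2⟩ := isEquilibrium_iff.1 heq q hq
    rw [hu.surfaceDiv_energyFlux hπ hS hSc.isClosed hq, h1, h2]
    simp
  have h0 := (hu.isTangentialField_energyFlux hπ hS hSc.isClosed).surfaceDiv_eq_zero hS hSc
    (fun q hq => by rw [hdiv q hq]; positivity) hp
  rw [hdiv p hp, mul_eq_zero, or_iff_right (by positivity),
    Finset.sum_eq_zero_iff_of_nonneg fun k _ => by positivity] at h0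
  refine ContinuousLinearMap.coe_injective
    ((EuclideanSpace.basisFun (Fin (d + 1)) ℝ).toBasis.ext fun k => ?_)
  simpa using h0 k (Finset.mem_univ k)

/-- For a field without strain the momentum equation reduces to `∇π = ∇(|u|² / 2)`, as
`P (u · ∇u) = -∇(|u|² / 2)`. -/
theorem IsTangentialField.inner_momentum_of_strain_eq_zero (hu : IsTangentialField 2 S u)
    (hπ : IsContDiffOnSurface 1 S π) (hS : IsSmoothHypersurface S) (hSc : IsClosed S)
    (hD : ∀ p ∈ S, strain S u p = 0) (hp : p ∈ S) (hw : w ∈ tangentSpace S p) :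
    inner ℝ (tangentProj S p (convect S u u p) -
        tangentProj S p (surfaceDivTensor S (stress μ S u π) p)) w =
      surfaceDeriv S π p w - inner ℝ (u p) (surfaceDeriv S u p w) := by
  have h1 : surfaceDeriv S (strain S u) p = 0 := by
    rw [surfaceDeriv_congr (g := fun _ => 0) hD hp, surfaceDeriv]
    simp
  have h2 := inner_strain S u p (u p) w
  rw [hD p hp, tangentProj_of_mem hw, tangentProj_of_mem (hu.2 p hp), zero_apply,
    inner_zero_left] at h2
  rw [hu.inner_momentum hπ hS hSc hp hw, inner_surfaceDivTensor, h1]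
  simp only [zero_apply, inner_zero_right, Finset.sum_const_zero]
  linarith

theorem IsTangentialField.exists_pressure_eq (hu : IsTangentialField 2 S u)
    (hπ : IsContDiffOnSurface 1 S π) (hS : IsSmoothHypersurface S) (hSc : IsClosed S)
    (hconn : IsConnected S) (hD : ∀ p ∈ S, strain S u p = 0) (heq : IsEquilibrium μ S u π) :
    ∃ c, ∀ p ∈ S, π p = 1 / 2 * ‖u p‖ ^ 2 + c := by
  obtain ⟨F, hF⟩ := (hu.1.of_le one_le_two).exists_normalExtension hS hSc le_rfl
  obtain ⟨H, hH⟩ := hπ.exists_normalExtension hS hSc le_rfl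
  obtain ⟨C, hC⟩ := hS.exists_eq_const (f := fun x => 1 / 2 * ‖u x‖ ^ 2 + -π x) hconn
    fun p hp => by
      have h1 := (hasFDerivAt_half_norm_sq_add (hF.hasFDerivAt p hp)
        (hH.hasFDerivAt p hp).neg).hasFDerivWithinAt (s := S)
      refine (h1.congr_fderiv ?_).congr (fun x hx => ?_) ?_
      · ext1 v
        have h2 := hu.inner_momentum_of_strain_eq_zero hπ hS hSc hD hp (μ := μ)
          (tangentProj_mem S p v)
        rw [(isEquilibrium_iff.1 heq p hp).1, inner_zero_left, surfaceDeriv_tangentProj,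
          surfaceDeriv_tangentProj] at h2
        simp only [add_apply, ContinuousLinearMap.comp_apply, innerSL_apply_apply, neg_apply,
          zero_apply, hF.eqOn hp]
        linarith
      · simp [hF.eqOn hx, hH.eqOn hx]
      · simp [hF.eqOn hp, hH.eqOn hp]
  exact ⟨-C, fun p hp => by linarith [hC p hp]⟩

theorem IsTangentialField.isContDiffOnSurface_half_norm_sq (hu : IsTangentialField 2 S u)
    (hS : IsSmoothHypersurface S) (hSc : IsClosed S) {c : ℝ}
    (hπ : ∀ p ∈ S, π p = 1 / 2 * ‖u p‖ ^ 2 + c) : IsContDiffOnSurface 1 S π := by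
  obtain ⟨F, hF⟩ := (hu.1.of_le one_le_two).exists_normalExtension hS hSc le_rfl
  refine ContDiff.isContDiffOnSurface (G := fun x => 1 / 2 * ‖F x‖ ^ 2 + c) ?_ fun x hx => ?_
  · exact (contDiff_const.mul (hF.contDiff.norm_sq ℝ)).add contDiff_const
  · simp [hF.eqOn hx, hπ x hx]

theorem IsTangentialField.isEquilibrium (hu : IsTangentialField 2 S u)
    (hS : IsSmoothHypersurface S) (hSc : IsClosed S) (hdiv : ∀ p ∈ S, surfaceDiv S u p = 0)
    (hD : ∀ p ∈ S, strain S u p = 0) {c : ℝ} (hπ : ∀ p ∈ S, π p = 1 / 2 * ‖u p‖ ^ 2 + c) :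
    IsEquilibrium μ S u π := by
  refine isEquilibrium_iff.2 fun p hp => ⟨?_, hdiv p hp⟩
  obtain ⟨F, hF⟩ := (hu.1.of_le one_le_two).exists_normalExtension hS hSc le_rfl
  have hπ1 := hu.isContDiffOnSurface_half_norm_sq hS hSc hπ
  have h1 := surfaceDeriv_eq (f := π)
    (hasFDerivAt_half_norm_sq_add (hF.hasFDerivAt p hp) (hasFDerivAt_const c p)) hp (by
      filter_upwards [self_mem_nhdsWithin] with x hx
      rw [hF.eqOn hx, hπ x hx])
  have h2 : ∀ w ∈ tangentSpace S p, surfaceDeriv S π p w =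
      inner ℝ (u p) (surfaceDeriv S u p w) := fun w hw => by
    rw [h1]
    simp [tangentProj_of_mem hw, hF.eqOn hp]
  rw [← map_sub]
  refine inner_self_eq_zero (𝕜 := ℝ).1 ?_
  nth_rewrite 1 [map_sub]
  rw [hu.inner_momentum_of_strain_eq_zero hπ1 hS hSc hD hp (tangentProj_mem S p _),
    h2 _ (tangentProj_mem S p _), sub_self]

end

end SurfaceNS

end

theorem proposition2p2 {d : ℕ} (S : Set (SurfaceNS.Ambient d))
    (hS : SurfaceNS.IsSmoothHypersurface S) (hcompact : IsCompact S) (hconn : IsConnected S)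
    (μ : ℝ) (hμ : 0 < μ) :
    -- (a) equilibria
    {q : (SurfaceNS.Ambient d → SurfaceNS.Ambient d) × (SurfaceNS.Ambient d → ℝ) |
        SurfaceNS.IsTangentialField 2 S q.1 ∧ SurfaceNS.IsContDiffOnSurface 1 S q.2 ∧
          SurfaceNS.IsEquilibrium μ S q.1 q.2} =
      {q : (SurfaceNS.Ambient d → SurfaceNS.Ambient d) × (SurfaceNS.Ambient d → ℝ) |
        SurfaceNS.IsTangentialField 2 S q.1 ∧
          (∀ p ∈ S, SurfaceNS.surfaceDiv S q.1 p = 0) ∧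
          (∀ p ∈ S, SurfaceNS.strain S q.1 p = 0) ∧
          ∃ c : ℝ, ∀ p ∈ S, q.2 p = 1 / 2 * ‖q.1 p‖ ^ 2 + c} ∧
    -- (b) vanishing strain implies vanishing divergence
    (∀ u : SurfaceNS.Ambient d → SurfaceNS.Ambient d, SurfaceNS.IsTangentialField 1 S u →
      (∀ p ∈ S, SurfaceNS.strain S u p = 0) → ∀ p ∈ S, SurfaceNS.surfaceDiv S u p = 0) ∧
    -- (c) fields of vanishing strain are the Killing fields
    (∀ u : SurfaceNS.Ambient d → SurfaceNS.Ambient d, SurfaceNS.IsTangentialField 1 S u →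
      ((∀ p ∈ S, SurfaceNS.strain S u p = 0) ↔ SurfaceNS.IsKillingField S u)) := by
  have hclosed := hcompact.isClosed
  refine ⟨?_, ?_, fun u _ => (SurfaceNS.isKillingField_iff hS).symm⟩
  · ext ⟨u, π⟩
    constructor
    · rintro ⟨hu, hπ, heq⟩
      have hD : ∀ p ∈ S, SurfaceNS.strain S u p = 0 := fun p hp =>
        hu.strain_eq_zero hπ hS hcompact hμ heq hp
      exact ⟨hu, fun p hp => (SurfaceNS.isEquilibrium_iff.1 heq p hp).2, hD,
        hu.exists_pressure_eq hπ hS hclosed hconn hD heq⟩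
    · rintro ⟨hu, hdiv, hD, c, hc⟩
      exact ⟨hu, hu.isContDiffOnSurface_half_norm_sq hS hclosed hc,
        hu.isEquilibrium hS hclosed hdiv hD hc⟩
  · intro u _ hD p hp
    rw [← SurfaceNS.trace_strain, hD p hp]
    simp
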